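/- Let $R>0$ and let $\Omega=\{x\in\mathbb R^7:|x|<R\}$. Let $\Delta$ be the Dirichlet Laplacian on $L^2(\Omega)$, let $H(t)=|\Omega|^{-1}\int_\Omega (e^{t\Delta}1)(x)\,dx$ ($t>0$) be the normalized heat content of $\Omega$ (equivalently $H(t)=\sum_j\gamma_j^2e^{-\lambda_jt}$ with $\gamma_j=|\Omega|^{-1/2}\int_\Omega\phi_j$, for an orthonormal basis of eigenfunctions $-\Delta\phi_j=\lambda_j\phi_j$, $\phi_j|_{\partial\Omega}=0$), and let $\tilde H(s)=\int_0^\infty e^{-s^2t}H(t)\,dt$ for $s>0$; this integral converges. Put $v_1=3^{-1/2}e^{i\pi/6}$ and $v_2=3^{-1/2}e^{-i\pi/6}$. (1) $v_1,v_2$ are exactly the roots of $1-3v+3v^2$, and for $v\in\mathbb C\setminus\{v_1,v_2\}$ $$\frac1{1-3v+3v^2}=\frac1{3(v_1-v_2)}\Big(\frac1{v-v_1}-\frac1{v-v_2}\Big),$$ which for $|v|<1/\sqrt3$ equals $\displaystyle\sum_{k=0}^\infty\frac{v^k}{3(v_1-v_2)}\Big(\frac1{v_2^{k+1}}-\frac1{v_1^{k+1}}\Big)$.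 (2) As $s\to\infty$, $\tilde H(s)$ has an asymptotic expansion $\tilde H(s)\sim\sum_{n\ge2}c_n/s^n$ with real coefficients (that is, $\tilde H(s)-\sum_{n=2}^N c_n/s^n=o(s^{-N})$ for every $N$), and its coefficients satisfy $$c_n=\frac{7}{R^{n-2}}\,3^{\frac n2-2}\Big[\cos\Big(\frac{n\pi}6\Big)-\sqrt3\,\sin\Big(\frac{n\pi}6\Big)\Big],\qquad n\ge5 .$$ (3) Apart from the geometric factor $(R/\sqrt3)^{-(n-2)}$ the coefficients are bounded and oscillate: for $n\ge5$ the numbers $g_n=c_n(R/\sqrt3)^{n-2}$ satisfy $|g_n|\le 14/3$ and $g_{n+12}=g_n$, and $c_n>0$ for infinitely many $n$ and $c_n<0$ for infinitely many $n$. They do not grow like a Gamma function: $c_n=o\big(\Gamma(n-\beta+1)/l^{\,n-2}\big)$ as $n\to\infty$ for all $\beta\in\mathbb R$ and $l>0$. (4) The characteristic length of the coefficients, i.e. the (only) $l>0$ for which $c_nl^{n-2}$ is bounded and does not tend to $0$, is $l=R/\sqrt3=R|v_1|=R|v_2|$. (5) The coefficients are quasi-periodic: $c_{n+12}=3^6R^{-12}c_n$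 for all $n\ge5$. -/

import Mathlib

open MeasureTheory Filter Topology Asymptotics
open scoped ContDiff

noncomputable section

namespace HeatContent

/-- `d`-dimensional Euclidean space. -/
abbrev Euc (d : ℕ) : Type := EuclideanSpace ℝ (Fin d)

/-- The complex Hilbert space `L²(Ω)`. -/
abbrev L2 {d : ℕ} (Ω : Set (Euc d)) : Type :=
  Lp ℂ 2 ((volume : Measure (Euc d)).restrict Ω)

/-- The Hilbert space `L²(Ω; ℂᵈ)` of square integrable vector fields. -/
abbrev L2Vec {d : ℕ} (Ω : Set (Euc d)) : Type :=
  Lp (EuclideanSpace ℂ (Fin d)) 2 ((volume : Measure (Euc d)).restrict Ω)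

/-- The classical gradient of a complex valued function, as the vector of its partial
derivatives. -/
def grad {d : ℕ} (φ : Euc d → ℂ) (x : Euc d) : EuclideanSpace ℂ (Fin d) :=
  WithLp.toLp 2 fun i => fderiv ℝ φ x (EuclideanSpace.single i 1)

/-- The pairs `(φ, ∇φ)`, where `φ` runs over the smooth functions with compact support in `Ω`. -/
def testPairs {d : ℕ} (Ω : Set (Euc d)) : Set (WithLp 2 (L2 Ω × L2Vec Ω)) :=
  {p | ∃ φ : Euc d → ℂ, ContDiff ℝ ∞ φ ∧ HasCompactSupport φ ∧ tsupport φ ⊆ Ω ∧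
    p.fst =ᵐ[volume.restrict Ω] φ ∧ p.snd =ᵐ[volume.restrict Ω] grad φ}

/-- The Sobolev space `H¹₀(Ω)`: the closure of the test functions in the `H¹` norm
`(‖u‖² + ‖∇u‖²)^(1/2)`. An element is stored as the pair `(u, ∇u)` of the function and its weak
gradient. (The test pairs form a linear subspace, so the span adds nothing to them.) -/
def H10 {d : ℕ} (Ω : Set (Euc d)) : Submodule ℂ (WithLp 2 (L2 Ω × L2Vec Ω)) :=
  (Submodule.span ℂ (testPairs Ω)).topologicalClosure

instance {d : ℕ} (Ω : Set (Euc d)) : CompleteSpace (H10 Ω) :=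
  (Submodule.isClosed_topologicalClosure _).completeSpace_coe

/-- The inclusion `H¹₀(Ω) → L²(Ω)`, `(u, ∇u) ↦ u`. -/
def incl {d : ℕ} (Ω : Set (Euc d)) : H10 Ω →L[ℂ] L2 Ω :=
  (WithLp.fstL 2 ℂ (L2 Ω) (L2Vec Ω)).comp (H10 Ω).subtypeL

/-- The resolvent `(1 - Δ)⁻¹` of the Dirichlet Laplacian `Δ` of `Ω`. Indeed, the adjoint of the
inclusion sends `f ∈ L²(Ω)` to the only `u ∈ H¹₀(Ω)` with
`∫ u ψ̄ + ∫ ∇u · ∇ψ̄ = ∫ f ψ̄` for all `ψ ∈ H¹₀(Ω)`, which is the weak form of `u - Δu = f` with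
Dirichlet boundary condition. -/
def resolvent {d : ℕ} (Ω : Set (Euc d)) : L2 Ω →L[ℂ] L2 Ω :=
  (incl Ω).comp (ContinuousLinearMap.adjoint (incl Ω))

/-- The function that takes the value `e^(-tμ)` at `x = 1/(1+μ)`, and `0` at `x ≤ 0`. For
`t > 0` it is continuous. -/
def heatSymbol (t x : ℝ) : ℝ :=
  if 0 < x then Real.exp (-t * (x⁻¹ - 1)) else 0

theorem isSelfAdjoint_resolvent {d : ℕ} (Ω : Set (Euc d)) : IsSelfAdjoint (resolvent Ω) := by
  rw [ContinuousLinearMap.isSelfAdjoint_iff']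
  simp [resolvent, ContinuousLinearMap.adjoint_comp]

theorem continuous_heatSymbol {t : ℝ} (ht : 0 < t) : Continuous (heatSymbol t) := by
  have h : heatSymbol t = fun x => Real.exp t * expNegInvGlue (x / t) := by
    funext x
    unfold heatSymbol expNegInvGlue
    by_cases hx : 0 < x
    · rw [if_pos hx, if_neg (not_le.2 (div_pos hx ht)), ← Real.exp_add]
      congr 1
      field_simp
      ring
    · rw [if_neg hx, if_pos (div_nonpos_of_nonpos_of_nonneg (not_lt.1 hx) ht.le), mul_zero]
  rw [h]
  exact continuous_const.mul
    ((expNegInvGlue.contDiff (n := 0)).continuous.comp (continuous_id.div_const t))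

/-- For a bounded self-adjoint operator `A` of the form `A = (1 + T)⁻¹` with `T ≥ 0` self-adjoint,
this is `e^(-tT)`, `t > 0`, through the continuous functional calculus. -/
def expOfResolvent {H : Type*} [NormedAddCommGroup H] [InnerProductSpace ℂ H] [CompleteSpace H]
    (A : H →L[ℂ] H) (t : ℝ) : H →L[ℂ] H :=
  cfc (p := IsSelfAdjoint) (heatSymbol t) A

/-- The heat semigroup `e^(tΔ)`, `t > 0`, of the Dirichlet Laplacian, obtained from its resolvent
by the functional calculus (which applies, by the two facts above). On an eigenfunction
`-Δφ = μφ`, `φ = 0` on `∂Ω`, it is multiplication by `e^(-tμ)`. Its integral kernel is the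
Dirichlet heat kernel `ρ(r, t | r₀, 0) = ∑ⱼ φⱼ(r₀) φⱼ(r) e^(-μⱼ t)`. -/
def heatSemigroup {d : ℕ} (Ω : Set (Euc d)) (t : ℝ) : L2 Ω →L[ℂ] L2 Ω :=
  expOfResolvent (resolvent Ω) t

/-- The local heat content `H(t; ·) = e^(tΔ) 1 = ∫_Ω ρ(r, t | ·, 0) dr` of a domain of finite
volume. -/
def localHeatContent {d : ℕ} (Ω : Set (Euc d)) [IsFiniteMeasure (volume.restrict Ω)] (t : ℝ) :
    L2 Ω :=
  heatSemigroup Ω t (Lp.const 2 (volume.restrict Ω) (1 : ℂ))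

/-- The normalized heat content `H(t) = |Ω|⁻¹ ∫_Ω H(t; r₀) dr₀`. -/
def heatContent {d : ℕ} (Ω : Set (Euc d)) [IsFiniteMeasure (volume.restrict Ω)] (t : ℝ) : ℝ :=
  ⨍ x in Ω, (localHeatContent Ω t x).re

/-- The Laplace transform `∫₀^∞ e^(-s² t) H(t) dt` of the normalized heat content. -/
def heatContentLaplace {d : ℕ} (Ω : Set (Euc d)) [IsFiniteMeasure (volume.restrict Ω)] (s : ℝ) :
    ℝ :=
  ∫ t in Set.Ioi (0 : ℝ), Real.exp (-s ^ 2 * t) * heatContent Ω t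

instance {d : ℕ} (x : Euc d) (R : ℝ) :
    IsFiniteMeasure ((volume : Measure (Euc d)).restrict (Metric.ball x R)) :=
  ⟨by rw [Measure.restrict_apply_univ]; exact measure_ball_lt_top⟩

/-- `F(s) ∼ ∑_{n ≥ 2} cₙ / sⁿ` as `s → ∞`, as an asymptotic series: for every `N` the error of
the partial sum up to `n = N` is `o(s^(-N))`. -/
def IsWeylSeries (F : ℝ → ℝ) (c : ℕ → ℝ) : Prop :=
  ∀ N : ℕ, (fun s : ℝ => F s - ∑ n ∈ Finset.Icc 2 N, c n / s ^ n) =o[atTop]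
    fun s : ℝ => 1 / s ^ N

/-- `l` is the characteristic length of the coefficients `cₙ`: we have `cₙ = gₙ / l^(n-2)` with a
bounded `gₙ` that does not tend to `0`. At most one `l` has this property. -/
def IsCharacteristicLength (c : ℕ → ℝ) (l : ℝ) : Prop :=
  0 < l ∧ (∃ B : ℝ, ∀ n : ℕ, 2 ≤ n → |c n * l ^ (n - 2)| ≤ B) ∧
    ¬ Tendsto (fun n : ℕ => c n * l ^ (n - 2)) atTop (𝓝 0)

/-- The root `3^(-1/2) e^(iπ/6)` of `1 - 3v + 3v²`. -/
def v₁ : ℂ := ((√3)⁻¹ : ℝ) * Complex.exp (Complex.I * Real.pi / 6)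

/-- The root `3^(-1/2) e^(-iπ/6)` of `1 - 3v + 3v²`. -/
def v₂ : ℂ := ((√3)⁻¹ : ℝ) * Complex.exp (-(Complex.I * Real.pi / 6))

end HeatContent

end

namespace HeatContent

/-! The Laplace transform of the heat semigroup at `s²` is the resolvent `(s² - Δ)⁻¹`, so the
transformed heat content is the mean over the ball of the solution of `(s² - Δ)u = 1`, `u = 0` on
the boundary. In dimension 7 this solution is explicit: if `f` is the third derivative of `cosh √ρ`,
then `f(s²|x|²)` satisfies `Δf = s²f`, and `u = (1 - f(s²|x|²)/f(s²R²))/s²`. Integrating in polar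
coordinates gives `(1 - 14 f'(s²R²)/f(s²R²))/s²` (`heatContentLaplace_ball_seven`).

Because 7 is odd, `f` and `f'` at `z²` are combinations of `sinh z` and `cosh z` with coefficients
rational in `z`. Their quotient is therefore a rational function of `v = 1/z`, with `z = sR`, plus a
term of order `e^(-z)` that no power of `1/s` sees (`coshSqrt_ratio`). The rational part has
denominator `1 - 3v + 3v²`, so the coefficients obey a linear recurrence whose characteristic roots
are `1/v₁`, `1/v₂ = √3 e^(∓iπ/6)`. The modulus of the roots gives the characteristic length `R/√3`,
the argument `π/6` the period 12.

On the analytic side, `u` is only known to be smooth and to have the right sign inside and outside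
the ball. Smooth truncation of its values puts it in `H¹₀` (`exists_mem_H10`), and Green's identity
against test functions then gives the weak equation (`resolvent_apply_eq`). -/

/-! ### Derivatives of `cosh √ρ` -/

/-- The coefficients of the `m`-th derivative of the entire function `ρ ↦ cosh √ρ`. -/
noncomputable def coshSqrtCoeff (m k : ℕ) : ℝ :=
  ((k + m).factorial : ℝ) / (k.factorial * (2 * (k + m)).factorial)

/-- The `m`-th derivative of the entire function `ρ ↦ cosh √ρ`. -/
noncomputable def coshSqrt (m : ℕ) (ρ : ℝ) : ℝ := ∑' k, coshSqrtCoeff m k * ρ ^ k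

theorem coshSqrtCoeff_pos (m k : ℕ) : 0 < coshSqrtCoeff m k := by
  unfold coshSqrtCoeff; positivity

theorem coshSqrtCoeff_le (m k : ℕ) : coshSqrtCoeff m k ≤ 1 / k.factorial := by
  unfold coshSqrtCoeff
  rw [div_le_div_iff₀ (by positivity) (by positivity)]
  have h : ((k + m).factorial : ℝ) ≤ (2 * (k + m)).factorial := by
    exact_mod_cast Nat.factorial_le (by omega)
  have h2 : (0 : ℝ) ≤ k.factorial := by positivity
  nlinarith

theorem coshSqrtCoeff_succ (m k : ℕ) :
    coshSqrtCoeff m (k + 1) * (k + 1) = coshSqrtCoeff (m + 1) k := by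
  unfold coshSqrtCoeff
  rw [show k + 1 + m = k + (m + 1) by ring, Nat.factorial_succ k]
  push_cast
  field_simp

/-- With `j = k + m`, the factorials leave `(2j + 2)(2j + 1)/(j + 1) = 4j + 2`. This is the
differential equation of `coshSqrt_rec` read on coefficients. -/
theorem coshSqrtCoeff_rec (m k : ℕ) :
    (4 * k + (4 * m + 2)) * coshSqrtCoeff (m + 1) k = coshSqrtCoeff m k := by
  unfold coshSqrtCoeff
  rw [show k + (m + 1) = k + m + 1 by ring, show 2 * (k + m + 1) = 2 * (k + m) + 1 + 1 by ring,
    Nat.factorial_succ (k + m), Nat.factorial_succ (2 * (k + m) + 1),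
    Nat.factorial_succ (2 * (k + m))]
  push_cast
  field_simp
  ring

theorem summable_coshSqrt (m : ℕ) (ρ : ℝ) : Summable fun k => coshSqrtCoeff m k * ρ ^ k := by
  refine .of_norm_bounded (Real.summable_pow_div_factorial |ρ|) fun k => ?_
  rw [norm_mul, norm_pow, Real.norm_eq_abs, Real.norm_eq_abs, abs_of_pos (coshSqrtCoeff_pos m k)]
  calc _ ≤ 1 / (k.factorial : ℝ) * |ρ| ^ k := by gcongr; exact coshSqrtCoeff_le m k
    _ = _ := by ring

/-- Termwise differentiation: on the ball of radius `|ρ| + 1` the differentiated series is dominated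
by its own value at the radius. -/
theorem hasDerivAt_coshSqrt (m : ℕ) (ρ : ℝ) :
    HasDerivAt (coshSqrt m) (coshSqrt (m + 1) ρ) ρ := by
  have hs : Summable fun k : ℕ => coshSqrtCoeff m k * (k * (|ρ| + 1) ^ (k - 1)) := by
    rw [← summable_nat_add_iff 1]
    convert! summable_coshSqrt (m + 1) (|ρ| + 1) using 2 with k
    rw [← coshSqrtCoeff_succ]
    push_cast
    ring
  have key := hasDerivAt_tsum_of_isPreconnected (g := fun k y => coshSqrtCoeff m k * y ^ k)
    (g' := fun k y => coshSqrtCoeff m k * (k * y ^ (k - 1))) (y₀ := ρ) (y := ρ) hs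
    (Metric.isOpen_ball (x := (0 : ℝ)) (ε := |ρ| + 1))
    (convex_ball (0 : ℝ) (|ρ| + 1)).isPreconnected
    (fun k y _ => (hasDerivAt_pow k y).const_mul _) (fun k y hy => ?_) (by simp)
    (summable_coshSqrt m ρ) (by simp)
  · refine key.congr_deriv ?_
    have hs' : Summable fun k : ℕ => coshSqrtCoeff m k * (k * ρ ^ (k - 1)) := by
      rw [← summable_nat_add_iff 1]
      convert! summable_coshSqrt (m + 1) ρ using 2 with k
      rw [← coshSqrtCoeff_succ]
      push_cast
      ring
    rw [hs'.tsum_eq_zero_add, coshSqrt]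
    simp only [Nat.cast_zero, zero_mul, mul_zero, zero_add]
    refine tsum_congr fun k => ?_
    rw [← coshSqrtCoeff_succ]
    push_cast
    ring
  · rw [norm_mul, norm_mul, norm_pow, Real.norm_eq_abs, Real.norm_eq_abs, Real.norm_eq_abs,
      abs_of_pos (coshSqrtCoeff_pos m k), Nat.abs_cast]
    have h : |y| ≤ |ρ| + 1 := by
      rw [mem_ball_zero_iff] at hy; exact hy.le
    have := (coshSqrtCoeff_pos m k).le
    gcongr

theorem contDiff_coshSqrt_nat (n : ℕ) : ∀ m : ℕ, ContDiff ℝ n (coshSqrt m) := by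
  induction n with
  | zero =>
    intro m
    exact contDiff_zero.2 (continuous_iff_continuousAt.2 fun ρ =>
      (hasDerivAt_coshSqrt m ρ).continuousAt)
  | succ n ih =>
    intro m
    have : ((n + 1 : ℕ) : WithTop ℕ∞) = (n : WithTop ℕ∞) + 1 := by push_cast; rfl
    rw [this, contDiff_succ_iff_deriv]
    refine ⟨fun ρ => (hasDerivAt_coshSqrt m ρ).differentiableAt, by simp, ?_⟩
    rw [show deriv (coshSqrt m) = coshSqrt (m + 1) from
      funext fun ρ => (hasDerivAt_coshSqrt m ρ).deriv]
    exact ih (m + 1)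

theorem contDiff_coshSqrt (m : ℕ) : ContDiff ℝ ∞ (coshSqrt m) :=
  contDiff_infty.2 fun n => contDiff_coshSqrt_nat n m

theorem coshSqrt_pos (m : ℕ) {ρ : ℝ} (hρ : 0 ≤ ρ) : 0 < coshSqrt m ρ := by
  refine (summable_coshSqrt m ρ).tsum_pos
    (fun k => mul_nonneg (coshSqrtCoeff_pos m k).le (pow_nonneg hρ k)) 0 ?_
  simpa using coshSqrtCoeff_pos m 0

/-- All Taylor coefficients are positive. This monotonicity later decides the sign of `u` inside and
outside the ball. -/
theorem coshSqrt_strictMonoOn (m : ℕ) : StrictMonoOn (coshSqrt m) (Set.Ici 0) := by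
  refine strictMonoOn_of_deriv_pos (convex_Ici 0)
    (contDiff_coshSqrt m).continuous.continuousOn fun ρ hρ => ?_
  rw [(hasDerivAt_coshSqrt m ρ).deriv]
  rw [interior_Ici] at hρ
  exact coshSqrt_pos _ (le_of_lt hρ)

/-- The differential equation of the derivatives of `cosh √ρ`. -/
theorem coshSqrt_rec (m : ℕ) (ρ : ℝ) :
    4 * ρ * coshSqrt (m + 2) ρ + (4 * m + 2) * coshSqrt (m + 1) ρ = coshSqrt m ρ := by
  have h1 : ρ * coshSqrt (m + 2) ρ = ∑' k : ℕ, k * (coshSqrtCoeff (m + 1) k * ρ ^ k) := by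
    have hs : Summable fun k : ℕ => k * (coshSqrtCoeff (m + 1) k * ρ ^ k) := by
      rw [← summable_nat_add_iff 1]
      convert! (summable_coshSqrt (m + 2) ρ).mul_left ρ using 2 with k
      rw [← coshSqrtCoeff_succ (m + 1)]
      push_cast; ring
    rw [hs.tsum_eq_zero_add, coshSqrt, ← tsum_mul_left]
    simp only [Nat.cast_zero, zero_mul, zero_add]
    refine tsum_congr fun k => ?_
    rw [← coshSqrtCoeff_succ (m + 1)]
    push_cast; ring
  have hs : Summable fun k : ℕ => k * (coshSqrtCoeff (m + 1) k * ρ ^ k) := by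
    rw [← summable_nat_add_iff 1]
    convert! (summable_coshSqrt (m + 2) ρ).mul_left ρ using 2 with k
    rw [← coshSqrtCoeff_succ (m + 1)]
    push_cast; ring
  rw [mul_assoc, h1, coshSqrt, coshSqrt, ← tsum_mul_left, ← tsum_mul_left,
    ← (hs.mul_left _).tsum_add ((summable_coshSqrt _ _).mul_left _)]
  refine tsum_congr fun k => ?_
  rw [← coshSqrtCoeff_rec m k]
  ring

theorem coshSqrt_zero_sq (r : ℝ) : coshSqrt 0 (r ^ 2) = Real.cosh r := by
  rw [← (Real.hasSum_cosh r).tsum_eq, coshSqrt]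
  refine tsum_congr fun k => ?_
  unfold coshSqrtCoeff
  rw [pow_mul]
  simp only [add_zero]
  field_simp

theorem coshSqrt_one_sq (r : ℝ) : 2 * r * coshSqrt 1 (r ^ 2) = Real.sinh r := by
  have h1 : HasDerivAt (fun r : ℝ => coshSqrt 0 (r ^ 2)) (coshSqrt 1 (r ^ 2) * (2 * r)) r := by
    simpa [Function.comp_def] using (hasDerivAt_coshSqrt 0 (r ^ 2)).comp r (hasDerivAt_pow 2 r)
  have h2 : (fun r : ℝ => coshSqrt 0 (r ^ 2)) = Real.cosh := funext coshSqrt_zero_sq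
  rw [h2] at h1
  rw [← h1.unique (Real.hasDerivAt_cosh r)]
  ring

theorem coshSqrt_three_sq (r : ℝ) :
    8 * r ^ 5 * coshSqrt 3 (r ^ 2) =
      r ^ 2 * Real.sinh r - 3 * r * Real.cosh r + 3 * Real.sinh r := by
  have h0 := coshSqrt_rec 0 (r ^ 2)
  have h1 := coshSqrt_rec 1 (r ^ 2)
  rw [coshSqrt_zero_sq] at h0
  rw [← coshSqrt_one_sq r, ← h0, ← h1]
  push_cast
  ring

theorem coshSqrt_four_sq (r : ℝ) :
    16 * r ^ 7 * coshSqrt 4 (r ^ 2) = r ^ 3 * Real.cosh r - 6 * r ^ 2 * Real.sinh r +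
      15 * r * Real.cosh r - 15 * Real.sinh r := by
  have h0 := coshSqrt_rec 0 (r ^ 2)
  have h1 := coshSqrt_rec 1 (r ^ 2)
  have h2 := coshSqrt_rec 2 (r ^ 2)
  rw [coshSqrt_zero_sq] at h0
  rw [← coshSqrt_one_sq r, ← h0, ← h1, ← h2]
  push_cast
  ring

/-! ### Laplace transform of the semigroup by functional calculus -/

theorem heatSymbol_eq {t : ℝ} (ht : 0 < t) (x : ℝ) :
    heatSymbol t x = Real.exp t * expNegInvGlue (x / t) := by
  unfold heatSymbol expNegInvGlue
  by_cases hx : 0 < x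
  · rw [if_pos hx, if_neg (not_le.2 (div_pos hx ht)), ← Real.exp_add]
    congr 1
    field_simp
    ring
  · rw [if_neg hx, if_pos (div_nonpos_of_nonpos_of_nonneg (not_lt.1 hx) ht.le), mul_zero]

theorem continuousOn_uncurry_heatSymbol :
    ContinuousOn (Function.uncurry heatSymbol) (Set.Ioi 0 ×ˢ Set.univ) := by
  have h : ContinuousOn (fun p : ℝ × ℝ => Real.exp p.1 * expNegInvGlue (p.2 / p.1))
      (Set.Ioi 0 ×ˢ Set.univ) := by
    refine (Real.continuous_exp.comp continuous_fst).continuousOn.mul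
      ((expNegInvGlue.contDiff (n := 0)).continuous.comp_continuousOn ?_)
    exact continuousOn_snd.div continuousOn_fst fun p hp => ne_of_gt hp.1
  exact h.congr fun p hp => heatSymbol_eq hp.1 p.2

theorem norm_heatSymbol_le {t x : ℝ} (ht : 0 ≤ t) (hx : x ≤ 1) : ‖heatSymbol t x‖ ≤ 1 := by
  unfold heatSymbol
  split_ifs with h
  · rw [Real.norm_eq_abs, Real.abs_exp, Real.exp_le_one_iff]
    have := (one_le_inv₀ h).2 hx
    nlinarith
  · simp

/-- For `x = 1/(1 + μ)` both sides are `1/(s² + μ)`; at `x = 0`, the value `μ = ∞`, both vanish. -/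
theorem integral_exp_mul_heatSymbol {s x : ℝ} (hs : 0 < s) (hx : x ∈ Set.Icc (0 : ℝ) 1) :
    ∫ t in Set.Ioi (0 : ℝ), Real.exp (-s ^ 2 * t) * heatSymbol t x =
      (1 + (s ^ 2 - 1) * x)⁻¹ * x := by
  rcases hx.1.eq_or_lt with rfl | h
  · simp [heatSymbol]
  · have hinv := (one_le_inv₀ h).2 hx.2
    have hneg : -(s ^ 2 + x⁻¹ - 1) < 0 := by nlinarith [pow_pos hs 2]
    have h1 : ∀ t : ℝ, Real.exp (-s ^ 2 * t) * heatSymbol t x =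
        Real.exp (-(s ^ 2 + x⁻¹ - 1) * t) := by
      intro t
      rw [heatSymbol, if_pos h, ← Real.exp_add]
      congr 1; ring
    simp_rw [h1]
    rw [integral_exp_mul_Ioi hneg]
    have h2 : s ^ 2 + x⁻¹ - 1 = (1 + (s ^ 2 - 1) * x) / x := by field_simp; ring
    rw [mul_zero, Real.exp_zero, neg_div_neg_eq, h2, one_div_div, div_eq_inv_mul]

section Abstract

variable {H : Type*} [NormedAddCommGroup H] [InnerProductSpace ℂ H] [CompleteSpace H]
  {A : H →L[ℂ] H} {s : ℝ}

/-- The expression is the convex combination `(1 - x) + s² x` of positive numbers. -/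
theorem one_add_mul_pos (hs : 0 < s) {x : ℝ} (hx : x ∈ Set.Icc (0 : ℝ) 1) :
    0 < 1 + (s ^ 2 - 1) * x := by
  nlinarith [hx.1, hx.2, pow_pos hs 2, mul_nonneg hx.1 (pow_pos hs 2).le]

theorem exp_smul_expOfResolvent (s : ℝ) {t : ℝ} (ht : 0 < t) :
    Real.exp (-s ^ 2 * t) • expOfResolvent A t =
      cfc (p := IsSelfAdjoint) (fun x => Real.exp (-s ^ 2 * t) * heatSymbol t x) A := by
  rw [expOfResolvent, cfc_const_mul _ _ A (continuous_heatSymbol ht).continuousOn]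

theorem continuousOn_exp_mul_heatSymbol (s : ℝ) (S : Set ℝ) :
    ContinuousOn (Function.uncurry fun t x : ℝ => Real.exp (-s ^ 2 * t) * heatSymbol t x)
      (Set.Ioi 0 ×ˢ S) := by
  refine ContinuousOn.mul (by fun_prop)
    (continuousOn_uncurry_heatSymbol.mono (Set.prod_mono_right (Set.subset_univ _)))

theorem norm_exp_mul_heatSymbol_le (s : ℝ) {t x : ℝ} (ht : 0 ≤ t) (hx : x ≤ 1) :
    ‖Real.exp (-s ^ 2 * t) * heatSymbol t x‖ ≤ Real.exp (-s ^ 2 * t) := by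
  rw [norm_mul, Real.norm_eq_abs, Real.abs_exp]
  exact mul_le_of_le_one_right (Real.exp_pos _).le (norm_heatSymbol_le ht hx)

theorem integrableOn_exp_smul_expOfResolvent (hA : IsSelfAdjoint A)
    (hsp : spectrum ℝ A ⊆ Set.Icc 0 1) (hs : 0 < s) :
    IntegrableOn (fun t : ℝ => Real.exp (-s ^ 2 * t) • expOfResolvent A t) (Set.Ioi 0) := by
  have h : IntegrableOn (fun t : ℝ => cfc (p := IsSelfAdjoint)
      (fun x => Real.exp (-s ^ 2 * t) * heatSymbol t x) A) (Set.Ioi 0) := by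
    refine integrableOn_cfc measurableSet_Ioi _ (fun t => Real.exp (-s ^ 2 * t)) A
      (continuousOn_exp_mul_heatSymbol s _) ?_ ?_ hA
    · exact ae_restrict_of_forall_mem measurableSet_Ioi fun t ht x hx =>
        norm_exp_mul_heatSymbol_le s (le_of_lt ht) (hsp hx).2
    · exact (integrableOn_exp_mul_Ioi (by nlinarith [pow_pos hs 2]) 0).hasFiniteIntegral
  exact h.congr_fun (fun t ht => (exp_smul_expOfResolvent s ht).symm) measurableSet_Ioi

/-- The Laplace transform of the semigroup is the resolvent. -/
theorem integral_exp_smul_expOfResolvent (hA : IsSelfAdjoint A)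
    (hsp : spectrum ℝ A ⊆ Set.Icc 0 1) (hs : 0 < s) :
    ∫ t in Set.Ioi (0 : ℝ), Real.exp (-s ^ 2 * t) • expOfResolvent A t =
      cfc (p := IsSelfAdjoint) (fun x : ℝ => (1 + (s ^ 2 - 1) * x)⁻¹ * x) A := by
  rw [setIntegral_congr_fun measurableSet_Ioi fun t ht => exp_smul_expOfResolvent s ht,
    ← cfc_setIntegral measurableSet_Ioi _ (fun t => Real.exp (-s ^ 2 * t)) A
      (continuousOn_exp_mul_heatSymbol s _) ?_ ?_ hA]
  · exact cfc_congr fun x hx => integral_exp_mul_heatSymbol hs (hsp hx)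
  · exact ae_restrict_of_forall_mem measurableSet_Ioi fun t ht x hx =>
      norm_exp_mul_heatSymbol_le s (le_of_lt ht) (hsp hx).2
  · exact (integrableOn_exp_mul_Ioi (by nlinarith [pow_pos hs 2]) 0).hasFiniteIntegral

/-- The resolvent equation identifies the Laplace transform of the semigroup. -/
theorem integral_exp_smul_expOfResolvent_apply (hA : IsSelfAdjoint A)
    (hsp : spectrum ℝ A ⊆ Set.Icc 0 1) (hs : 0 < s) {f u : H}
    (hu : A (f - ((s ^ 2 - 1 : ℝ) : ℂ) • u) = u) :
    (∫ t in Set.Ioi (0 : ℝ), Real.exp (-s ^ 2 * t) • expOfResolvent A t) f = u := by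
  have hc : ContinuousOn (fun x : ℝ => (1 + (s ^ 2 - 1) * x)⁻¹) (spectrum ℝ A) :=
    ContinuousOn.inv₀ (by fun_prop) fun x hx => (one_add_mul_pos hs (hsp hx)).ne'
  rw [integral_exp_smul_expOfResolvent hA hsp hs]
  set B := cfc (p := IsSelfAdjoint) (fun x : ℝ => (1 + (s ^ 2 - 1) * x)⁻¹) A with hB
  have h1 : cfc (p := IsSelfAdjoint) (fun x : ℝ => (1 + (s ^ 2 - 1) * x)⁻¹ * x) A = B * A := by
    rw [cfc_mul _ (fun x => x) A hc continuousOn_id, cfc_id' ℝ A]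
  have h2 : B * (1 + (s ^ 2 - 1) • A) = 1 := by
    have h3 : cfc (p := IsSelfAdjoint) (fun x : ℝ => 1 + (s ^ 2 - 1) * x) A =
        1 + (s ^ 2 - 1) • A := by
      rw [cfc_const_add _ _ A (by fun_prop), cfc_const_mul _ _ A (by fun_prop), cfc_id' ℝ A]
      simp
    rw [← h3, hB, ← cfc_mul _ _ A hc (by fun_prop), ← cfc_one ℝ A]
    exact cfc_congr fun x hx => inv_mul_cancel₀ (one_add_mul_pos hs (hsp hx)).ne'
  -- The hypothesis on `u` is rearranged so that `B`, a left inverse of `1 + (s² - 1)A`, recovers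
  -- `u` from `A f`.
  have h4 : A f = (1 + (s ^ 2 - 1) • A : H →L[ℂ] H) u := by
    rw [map_sub, map_smul, sub_eq_iff_eq_add] at hu
    rw [hu, Complex.coe_smul]
    rfl
  rw [h1, mul_apply_eq_comp, h4, ← mul_apply_eq_comp, h2]
  rfl

end Abstract

/-! ### Reduction of the heat content to a resolvent equation -/

theorem norm_incl_le {d : ℕ} (Ω : Set (Euc d)) : ‖incl Ω‖ ≤ 1 := by
  refine ContinuousLinearMap.opNorm_le_bound _ zero_le_one fun u => ?_
  rw [one_mul]
  exact WithLp.norm_fst_le _ (u : WithLp 2 (L2 Ω × L2Vec Ω))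

/-- The resolvent is `ι ι*` with `‖ι‖ ≤ 1`, hence positive and of norm at most 1. -/
theorem spectrum_resolvent_subset {d : ℕ} (Ω : Set (Euc d)) :
    spectrum ℝ (resolvent Ω) ⊆ Set.Icc 0 1 := by
  intro x hx
  have hpos : 0 ≤ resolvent Ω := by
    rw [ContinuousLinearMap.nonneg_iff_isPositive]
    exact ContinuousLinearMap.isPositive_self_comp_adjoint _
  have hnorm : ‖resolvent Ω‖ ≤ 1 := by
    refine (ContinuousLinearMap.opNorm_comp_le _ _).trans ?_
    rw [LinearIsometryEquiv.norm_map]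
    exact mul_le_one₀ (norm_incl_le Ω) (norm_nonneg (incl Ω)) (norm_incl_le Ω)
  refine ⟨spectrum_nonneg_of_nonneg hpos hx, ?_⟩
  have h := spectrum.norm_le_norm_mul_of_mem hx
  have h1 : ‖(1 : L2 Ω →L[ℂ] L2 Ω)‖ ≤ 1 := ContinuousLinearMap.norm_id_le
  calc x ≤ ‖x‖ := Real.le_norm_self x
    _ ≤ _ := h
    _ ≤ 1 := mul_le_one₀ hnorm (norm_nonneg _) h1

section Average

variable {d : ℕ} {Ω : Set (Euc d)} [IsFiniteMeasure (volume.restrict Ω)]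

/-- As an inner product with 1, the mean is a bounded functional and so commutes with the
operator-valued integral over `t`. -/
theorem average_re_eq_inner (f : L2 Ω) :
    ⨍ x in Ω, (f x).re = (volume.real Ω)⁻¹ *
      (inner ℂ (Lp.const 2 (volume.restrict Ω) (1 : ℂ)) f).re := by
  have hf : Integrable f (volume.restrict Ω) := (Lp.memLp f).integrable (by norm_num)
  rw [setAverage_eq, smul_eq_mul, L2.inner_def]
  congr 1
  have h : ∀ᵐ x ∂(volume.restrict Ω),
      inner ℂ ((Lp.const 2 (volume.restrict Ω) (1 : ℂ)) x) (f x) = f x := by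
    filter_upwards [Lp.coeFn_const (p := 2) (μ := volume.restrict Ω) (1 : ℂ)] with x hx
    rw [hx]
    simp
  rw [integral_congr_ae h]
  exact integral_re hf

/-- The mean of the real part of `T 1`, as a functional of the operator `T`. -/
noncomputable def meanOfOne (Ω : Set (Euc d)) [IsFiniteMeasure (volume.restrict Ω)] :
    (L2 Ω →L[ℂ] L2 Ω) →L[ℝ] ℝ :=
  (volume.real Ω)⁻¹ • Complex.reCLM.comp
    (((innerSL ℂ (Lp.const 2 (volume.restrict Ω) (1 : ℂ))).comp
      (ContinuousLinearMap.apply ℂ (L2 Ω)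
        (Lp.const 2 (volume.restrict Ω) (1 : ℂ)))).restrictScalars ℝ)

theorem meanOfOne_apply (T : L2 Ω →L[ℂ] L2 Ω) :
    meanOfOne Ω T = ⨍ x in Ω, (T (Lp.const 2 (volume.restrict Ω) (1 : ℂ)) x).re := by
  rw [average_re_eq_inner]
  rfl

theorem exp_mul_heatContent (s t : ℝ) :
    Real.exp (-s ^ 2 * t) * heatContent Ω t =
      meanOfOne Ω (Real.exp (-s ^ 2 * t) • expOfResolvent (resolvent Ω) t) := by
  rw [map_smul, meanOfOne_apply]
  rfl

theorem integrableOn_exp_mul_heatContent {s : ℝ} (hs : 0 < s) :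
    IntegrableOn (fun t : ℝ => Real.exp (-s ^ 2 * t) * heatContent Ω t) (Set.Ioi 0) := by
  simp_rw [exp_mul_heatContent]
  exact (meanOfOne Ω).integrable_comp (integrableOn_exp_smul_expOfResolvent
    (isSelfAdjoint_resolvent Ω) (spectrum_resolvent_subset Ω) hs)

/-- The hypothesis is `(s² - Δ)u = 1` written with `(1 - Δ)⁻¹`: `u - Δu = 1 - (s² - 1)u`. -/
theorem heatContentLaplace_eq_average {s : ℝ} (hs : 0 < s) {u : L2 Ω}
    (hu : resolvent Ω (Lp.const 2 (volume.restrict Ω) (1 : ℂ) - ((s ^ 2 - 1 : ℝ) : ℂ) • u) = u) :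
    heatContentLaplace Ω s = ⨍ x in Ω, (u x).re := by
  unfold heatContentLaplace
  simp_rw [exp_mul_heatContent]
  refine ((meanOfOne Ω).integral_comp_comm (integrableOn_exp_smul_expOfResolvent
    (isSelfAdjoint_resolvent Ω) (spectrum_resolvent_subset Ω) hs)).trans ?_
  rw [meanOfOne_apply]
  exact congrArg (fun f : L2 Ω => ⨍ x in Ω, (f x).re)
    (integral_exp_smul_expOfResolvent_apply (isSelfAdjoint_resolvent Ω)
      (spectrum_resolvent_subset Ω) hs hu)

end Average

/-! ### Smooth functions in `H¹₀` by truncation of values -/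

/-- Bounded convergence in `Lᵖ` of a finite measure space. -/
theorem tendsto_eLpNorm_of_bounded {α E : Type*} [MeasurableSpace α] {μ : Measure α}
    [IsFiniteMeasure μ] [NormedAddCommGroup E] {p : ENNReal} (hp : 1 ≤ p) (hp' : p ≠ ⊤)
    {f : ℕ → α → E} {g : α → E} (hf : ∀ n, AEStronglyMeasurable (f n) μ) (hg : MemLp g p μ)
    (C : ℝ) (hC : ∀ n, ∀ᵐ x ∂μ, ‖f n x‖ ≤ C)
    (hfg : ∀ᵐ x ∂μ, Tendsto (fun n => f n x) atTop (𝓝 (g x))) :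
    Tendsto (fun n => eLpNorm (f n - g) p μ) atTop (𝓝 0) := by
  refine tendsto_Lp_finite_of_tendsto_ae hp hp' hf hg
    (unifIntegrable_of hp hp' hf fun ε _ => ⟨(C + 1).toNNReal, fun n => ?_⟩) hfg
  -- The threshold `C + 1` lies strictly above the bound, so the set of large values is null.
  have h : {x | (C + 1).toNNReal ≤ ‖f n x‖₊}.indicator (f n) =ᵐ[μ] 0 := by
    filter_upwards [hC n] with x hx
    refine Set.indicator_of_notMem (fun hmem => ?_) _
    have h1 : C + 1 ≤ ‖f n x‖ := (Real.le_coe_toNNReal _).trans (NNReal.coe_le_coe.2 hmem)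
    linarith
  rw [eLpNorm_congr_ae h, eLpNorm_zero]
  exact zero_le

/-- A smooth function which vanishes on `τ ≤ 1` and equals `τ` for `τ ≥ 2`. -/
noncomputable def smoothTrunc (τ : ℝ) : ℝ := τ * Real.smoothTransition (τ - 1)

theorem contDiff_smoothTrunc {n : ℕ∞} : ContDiff ℝ n smoothTrunc :=
  contDiff_id.mul (Real.smoothTransition.contDiff.comp (contDiff_id.sub contDiff_const))

theorem smoothTrunc_of_le_one {τ : ℝ} (h : τ ≤ 1) : smoothTrunc τ = 0 := by
  rw [smoothTrunc, Real.smoothTransition.zero_of_nonpos (by linarith), mul_zero]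

theorem smoothTrunc_of_two_le {τ : ℝ} (h : 2 ≤ τ) : smoothTrunc τ = τ := by
  rw [smoothTrunc, Real.smoothTransition.one_of_one_le (by linarith), mul_one]

theorem abs_smoothTrunc_le (τ : ℝ) : |smoothTrunc τ| ≤ |τ| := by
  rw [smoothTrunc, abs_mul, abs_of_nonneg (Real.smoothTransition.nonneg _)]
  exact mul_le_of_le_one_right (abs_nonneg _) (Real.smoothTransition.le_one _)

theorem deriv_smoothTrunc_of_lt_one {τ : ℝ} (h : τ < 1) : deriv smoothTrunc τ = 0 := by
  have : smoothTrunc =ᶠ[𝓝 τ] fun _ => 0 := by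
    filter_upwards [Iio_mem_nhds h] with y hy using smoothTrunc_of_le_one (le_of_lt hy)
  rw [this.deriv_eq, deriv_const]

theorem deriv_smoothTrunc_of_two_lt {τ : ℝ} (h : 2 < τ) : deriv smoothTrunc τ = 1 := by
  have : smoothTrunc =ᶠ[𝓝 τ] id := by
    filter_upwards [Ioi_mem_nhds h] with y hy using smoothTrunc_of_two_le (le_of_lt hy)
  rw [this.deriv_eq, deriv_id]

theorem exists_abs_deriv_smoothTrunc_le : ∃ M : ℝ, ∀ τ, |deriv smoothTrunc τ| ≤ M := by
  obtain ⟨M, hM⟩ := (isCompact_Icc (a := (1 : ℝ)) (b := 2)).exists_bound_of_continuousOn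
    ((contDiff_smoothTrunc (n := 1)).continuous_deriv le_rfl).continuousOn
  refine ⟨max M 1, fun τ => ?_⟩
  rcases lt_or_ge τ 1 with h | h
  · simp [deriv_smoothTrunc_of_lt_one h]
  · rcases lt_or_ge 2 τ with h' | h'
    · simp [deriv_smoothTrunc_of_two_lt h']
    · exact (hM τ ⟨h, h'⟩).trans (le_max_left _ _)

variable {d : ℕ}

theorem fderiv_ofReal_comp {u : Euc d → ℝ} {x : Euc d} (hu : DifferentiableAt ℝ u x) (v : Euc d) :
    fderiv ℝ (fun y => (u y : ℂ)) x v = (fderiv ℝ u x v : ℝ) := by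
  have h := (Complex.ofRealCLM.hasFDerivAt (x := u x)).comp x hu.hasFDerivAt
  have h2 : fderiv ℝ (fun y => (u y : ℂ)) x = Complex.ofRealCLM.comp (fderiv ℝ u x) := h.fderiv
  rw [h2]
  rfl

theorem contDiff_ofReal_comp {u : Euc d → ℝ} {n : WithTop ℕ∞} (hu : ContDiff ℝ n u) :
    ContDiff ℝ n fun y => (u y : ℂ) :=
  Complex.ofRealCLM.contDiff.comp hu

theorem continuous_grad {φ : Euc d → ℂ} (hφ : ContDiff ℝ ∞ φ) : Continuous (grad φ) := by
  refine (PiLp.continuous_toLp 2 _).comp (continuous_pi fun i => ?_)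
  exact (hφ.continuous_fderiv (by simp)).clm_apply continuous_const

theorem grad_comp {u : Euc d → ℝ} {χ : ℝ → ℝ} {x : Euc d} (hu : DifferentiableAt ℝ u x)
    (hχ : DifferentiableAt ℝ χ (u x)) :
    grad (fun y => (χ (u y) : ℂ)) x = ((deriv χ (u x) : ℝ) : ℂ) • grad (fun y => (u y : ℂ)) x := by
  have h : fderiv ℝ (fun y => χ (u y)) x = deriv χ (u x) • fderiv ℝ u x :=
    (hχ.hasDerivAt.comp_hasFDerivAt x hu.hasFDerivAt).fderiv
  ext i
  simp only [grad, PiLp.smul_apply, smul_eq_mul]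
  rw [fderiv_ofReal_comp (u := fun y => χ (u y)) (hχ.comp x hu), fderiv_ofReal_comp hu, h]
  simp

/-- A continuous function is bounded on a bounded set. -/
theorem exists_bound_of_isBounded {E : Type*} [NormedAddCommGroup E] {Ω : Set (Euc d)}
    (hΩ : Bornology.IsBounded Ω) {f : Euc d → E} (hf : Continuous f) :
    ∃ C, ∀ x ∈ Ω, ‖f x‖ ≤ C := by
  obtain ⟨C, hC⟩ := hΩ.isCompact_closure.exists_bound_of_continuousOn hf.continuousOn
  exact ⟨C, fun x hx => hC x (subset_closure hx)⟩

theorem memLp_of_continuous {E : Type*} [NormedAddCommGroup E] [SecondCountableTopology E]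
    {Ω : Set (Euc d)}
    [IsFiniteMeasure (volume.restrict Ω)] (hΩ : Bornology.IsBounded Ω) (hm : MeasurableSet Ω)
    {f : Euc d → E} (hf : Continuous f) : MemLp f 2 (volume.restrict Ω) := by
  obtain ⟨C, hC⟩ := exists_bound_of_isBounded hΩ hf
  exact .of_bound hf.aestronglyMeasurable C (ae_restrict_of_forall_mem hm hC)

/-- A smooth function which is positive in a bounded domain and nonpositive outside lies in the
Sobolev space `H¹₀` of the domain. -/
theorem exists_mem_H10 {Ω : Set (Euc d)} [IsFiniteMeasure (volume.restrict Ω)]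
    (hΩ : Bornology.IsBounded Ω) (hm : MeasurableSet Ω) {u : Euc d → ℝ} (hu : ContDiff ℝ ∞ u)
    (hpos : ∀ x ∈ Ω, 0 < u x) (hneg : ∀ x ∉ Ω, u x ≤ 0) :
    ∃ U ∈ H10 Ω, U.fst =ᵐ[volume.restrict Ω] (fun x => (u x : ℂ)) ∧
      U.snd =ᵐ[volume.restrict Ω] grad fun x => (u x : ℂ) := by
  have hd : Differentiable ℝ u := hu.differentiable (by simp)
  have hgc : Continuous (grad fun x => (u x : ℂ)) := continuous_grad (contDiff_ofReal_comp hu)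
  have huc : Continuous fun x => (u x : ℂ) := Complex.continuous_ofReal.comp hu.continuous
  have hL := memLp_of_continuous hΩ hm huc
  have hLg := memLp_of_continuous hΩ hm hgc
  -- `χ n` vanishes for `t ≤ 1/(n+1)` and is the identity for `t ≥ 2/(n+1)`. The scaling leaves the
  -- bound on its derivative independent of `n`, so the gradients of `χ n ∘ u` stay bounded.
  let χ : ℕ → ℝ → ℝ := fun n t => smoothTrunc ((n + 1) * t) / (n + 1)
  have hχs : ∀ n, ContDiff ℝ ∞ (χ n) := fun n =>
    (contDiff_smoothTrunc.comp (contDiff_const.mul contDiff_id)).div_const _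
  have hχd : ∀ n t, deriv (χ n) t = deriv smoothTrunc ((n + 1) * t) := by
    intro n t
    have h1 : HasDerivAt smoothTrunc (deriv smoothTrunc ((n + 1) * t)) ((n + 1) * t) :=
      ((contDiff_smoothTrunc (n := 1)).differentiable one_ne_zero _).hasDerivAt
    have h2 : HasDerivAt (fun t : ℝ => ((n : ℝ) + 1) * t) ((n : ℝ) + 1) t := by
      simpa using (hasDerivAt_id t).const_mul ((n : ℝ) + 1)
    refine ((h1.comp t h2).div_const ((n : ℝ) + 1)).deriv.trans ?_
    have : (n : ℝ) + 1 ≠ 0 := by positivity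
    field_simp
  let φ : ℕ → Euc d → ℂ := fun n x => (χ n (u x) : ℂ)
  have hφs : ∀ n, ContDiff ℝ ∞ (φ n) := fun n => contDiff_ofReal_comp ((hχs n).comp hu)
  have hφg : ∀ n x, grad (φ n) x =
      ((deriv smoothTrunc ((n + 1) * u x) : ℝ) : ℂ) • grad (fun y => (u y : ℂ)) x := by
    intro n x
    rw [← hχd, ← grad_comp (hd x) ((hχs n).differentiable (by simp) _)]
  have hsupp : ∀ n, tsupport (φ n) ⊆ {x | 1 ≤ (n + 1) * u x} := by
    intro n
    refine closure_minimal (fun x hx => ?_)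
      (isClosed_le continuous_const (continuous_const.mul hu.continuous))
    by_contra h
    refine hx ?_
    simp only [Set.mem_ofPred_eq, not_le] at h
    simp [φ, χ, smoothTrunc_of_le_one h.le]
  have hsuppΩ : ∀ n, tsupport (φ n) ⊆ Ω := by
    intro n x hx
    by_contra h
    have h1 : (1 : ℝ) ≤ (n + 1) * u x := hsupp n hx
    have h2 : (0 : ℝ) < n + 1 := by positivity
    nlinarith [hneg x h]
  have hcomp : ∀ n, HasCompactSupport (φ n) := fun n =>
    Metric.isCompact_of_isClosed_isBounded (isClosed_tsupport _) (hΩ.subset (hsuppΩ n))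
  -- At each point of `Ω` the truncation is eventually inactive, so the values and the gradients are
  -- eventually constant there.
  have hlarge : ∀ x ∈ Ω, ∀ᶠ n : ℕ in atTop, 2 < (n + 1) * u x := by
    intro x hx
    have : Tendsto (fun n : ℕ => ((n : ℝ) + 1) * u x) atTop atTop :=
      (tendsto_atTop_add_const_right _ _ tendsto_natCast_atTop_atTop).atTop_mul_const (hpos x hx)
    exact this.eventually_gt_atTop 2
  have hφL : ∀ n, MemLp (φ n) 2 (volume.restrict Ω) := fun n =>
    memLp_of_continuous hΩ hm (hφs n).continuous
  have hφgL : ∀ n, MemLp (grad (φ n)) 2 (volume.restrict Ω) := fun n =>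
    memLp_of_continuous hΩ hm (continuous_grad (hφs n))
  have hlim1 : Tendsto (fun n => (hφL n).toLp (φ n)) atTop (𝓝 (hL.toLp _)) := by
    rw [Lp.tendsto_Lp_iff_tendsto_eLpNorm'']
    obtain ⟨C, hC⟩ := exists_bound_of_isBounded hΩ huc
    refine tendsto_eLpNorm_of_bounded (by norm_num) (by norm_num)
      (fun n => (hφL n).aestronglyMeasurable) hL C
      (fun n => ae_restrict_of_forall_mem hm fun x hx => ?_)
      (ae_restrict_of_forall_mem hm fun x hx => ?_)
    · refine le_trans ?_ (hC x hx)
      simp only [φ, χ, Complex.norm_real, Real.norm_eq_abs]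
      have h2 : (0 : ℝ) < n + 1 := by positivity
      rw [abs_div, abs_of_pos h2, div_le_iff₀ h2]
      refine (abs_smoothTrunc_le _).trans ?_
      rw [abs_mul, abs_of_pos h2, mul_comm]
    · refine tendsto_const_nhds.congr' ?_
      filter_upwards [hlarge x hx] with n hn
      have h2 : (n : ℝ) + 1 ≠ 0 := by positivity
      simp only [φ, χ, smoothTrunc_of_two_le hn.le]
      rw [mul_div_cancel_left₀ _ h2]
  have hlim2 : Tendsto (fun n => (hφgL n).toLp (grad (φ n))) atTop (𝓝 (hLg.toLp _)) := by
    rw [Lp.tendsto_Lp_iff_tendsto_eLpNorm'']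
    obtain ⟨C, hC⟩ := exists_bound_of_isBounded hΩ hgc
    obtain ⟨M, hM⟩ := exists_abs_deriv_smoothTrunc_le
    refine tendsto_eLpNorm_of_bounded (by norm_num) (by norm_num)
      (fun n => (hφgL n).aestronglyMeasurable) hLg (M * C)
      (fun n => ae_restrict_of_forall_mem hm fun x hx => ?_)
      (ae_restrict_of_forall_mem hm fun x hx => ?_)
    · rw [hφg, norm_smul, Complex.norm_real, Real.norm_eq_abs]
      exact mul_le_mul (hM _) (hC x hx) (norm_nonneg _) ((abs_nonneg _).trans (hM 0))
    · refine tendsto_const_nhds.congr' ?_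
      filter_upwards [hlarge x hx] with n hn
      rw [hφg, deriv_smoothTrunc_of_two_lt hn, Complex.ofReal_one, one_smul]
  refine ⟨WithLp.toLp 2 (hL.toLp _, hLg.toLp _), ?_, hL.coeFn_toLp, hLg.coeFn_toLp⟩
  have hlim : Tendsto (fun n => WithLp.toLp 2 ((hφL n).toLp (φ n), (hφgL n).toLp (grad (φ n))))
      atTop (𝓝 (WithLp.toLp 2 (hL.toLp (fun x => (u x : ℂ)),
        hLg.toLp (grad fun x => (u x : ℂ))))) :=
    ((WithLp.prod_continuous_toLp 2 _ _).tendsto _).comp (hlim1.prodMk_nhds hlim2)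
  refine (Submodule.isClosed_topologicalClosure _).mem_of_tendsto hlim
    (Eventually.of_forall fun n => ?_)
  refine Submodule.le_topologicalClosure _ (Submodule.subset_span ?_)
  exact ⟨φ n, hφs n, hcomp n, hsuppΩ n, (hφL n).coeFn_toLp, (hφgL n).coeFn_toLp⟩

/-! ### Green's identity and the weak equation -/

/-- The Laplacian of a smooth real function, as the sum of the second partial derivatives. -/
noncomputable def lap (u : Euc d → ℝ) (x : Euc d) : ℝ :=
  ∑ i, fderiv ℝ (fun y => fderiv ℝ u y (EuclideanSpace.single i 1)) x (EuclideanSpace.single i 1)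

theorem contDiff_partial {u : Euc d → ℝ} (hu : ContDiff ℝ ∞ u) (v : Euc d) :
    ContDiff ℝ ∞ fun y => fderiv ℝ u y v :=
  (hu.fderiv_right (by simp)).clm_apply contDiff_const

theorem continuous_lap {u : Euc d → ℝ} (hu : ContDiff ℝ ∞ u) : Continuous (lap u) :=
  continuous_finsetSum _ fun _ _ =>
    ((contDiff_partial hu _).continuous_fderiv (by simp)).clm_apply continuous_const

/-- Green's identity against a test function. -/
theorem integral_inner_grad {u : Euc d → ℝ} (hu : ContDiff ℝ ∞ u) {φ : Euc d → ℂ}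
    (hφ : ContDiff ℝ ∞ φ) (hc : HasCompactSupport φ) :
    ∫ x, inner ℂ (grad (fun y => (u y : ℂ)) x) (grad φ x) = -∫ x, (lap u x : ℂ) * φ x := by
  have hφc : ∀ v : Euc d, Continuous fun x => fderiv ℝ φ x v := fun v =>
    (hφ.continuous_fderiv (by simp)).clm_apply continuous_const
  have hφcs : ∀ v : Euc d, HasCompactSupport fun x => fderiv ℝ φ x v := fun v =>
    hc.fderiv_apply ℝ v
  have hp : ∀ v : Euc d, ContDiff ℝ ∞ fun x => ((fderiv ℝ u x v : ℝ) : ℂ) := fun v =>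
    contDiff_ofReal_comp (contDiff_partial hu v)
  have hpp : ∀ v x : Euc d, fderiv ℝ (fun x => ((fderiv ℝ u x v : ℝ) : ℂ)) x v =
      (fderiv ℝ (fun y => fderiv ℝ u y v) x v : ℝ) := fun v x =>
    fderiv_ofReal_comp ((contDiff_partial hu v).differentiable (by simp) x) v
  have hint1 : ∀ v : Euc d, Integrable fun x => ((fderiv ℝ u x v : ℝ) : ℂ) * fderiv ℝ φ x v :=
    fun v => ((hp v).continuous.mul (hφc v)).integrable_of_hasCompactSupport (hφcs v).mul_left
  have hint2 : ∀ v : Euc d, Integrable fun x =>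
      fderiv ℝ (fun x => ((fderiv ℝ u x v : ℝ) : ℂ)) x v * φ x := fun v =>
    ((((hp v).continuous_fderiv (by simp)).clm_apply continuous_const).mul
      hφ.continuous).integrable_of_hasCompactSupport hc.mul_left
  have hint3 : ∀ v : Euc d, Integrable fun x => ((fderiv ℝ u x v : ℝ) : ℂ) * φ x :=
    fun v => ((hp v).continuous.mul hφ.continuous).integrable_of_hasCompactSupport hc.mul_left
  have hparts : ∀ v : Euc d, ∫ x, ((fderiv ℝ u x v : ℝ) : ℂ) * fderiv ℝ φ x v =
      -∫ x, fderiv ℝ (fun x => ((fderiv ℝ u x v : ℝ) : ℂ)) x v * φ x := fun v =>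
    integral_mul_fderiv_eq_neg_fderiv_mul_of_integrable (hint2 v) (hint1 v) (hint3 v)
      (fun x _ => (hp v).differentiable (by simp) x) fun x _ => hφ.differentiable (by simp) x
  have h1 : ∀ x, inner ℂ (grad (fun y => (u y : ℂ)) x) (grad φ x) =
      ∑ i : Fin d, ((fderiv ℝ u x (EuclideanSpace.single i 1) : ℝ) : ℂ) *
        fderiv ℝ φ x (EuclideanSpace.single i 1) := by
    intro x
    rw [PiLp.inner_apply]
    refine Finset.sum_congr rfl fun i _ => ?_
    simp only [grad]
    rw [fderiv_ofReal_comp (hu.differentiable (by simp) x), RCLike.inner_apply,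
      Complex.conj_ofReal, mul_comm]
  simp_rw [h1]
  rw [integral_finsetSum _ fun i _ => hint1 _]
  simp_rw [hparts]
  rw [Finset.sum_neg_distrib, ← integral_finsetSum _ fun i _ => hint2 _]
  congr 1
  refine integral_congr_ae (Eventually.of_forall fun x => ?_)
  simp only [lap, hpp]
  rw [← Finset.sum_mul, Complex.ofReal_sum]

/-- A smooth function which vanishes on the boundary is the image of `u - Δu` under the resolvent
of the Dirichlet Laplacian. -/
theorem resolvent_apply_eq {Ω : Set (Euc d)} [IsFiniteMeasure (volume.restrict Ω)]
    (hΩ : Bornology.IsBounded Ω) (hm : MeasurableSet Ω) {u : Euc d → ℝ} (hu : ContDiff ℝ ∞ u)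
    (hpos : ∀ x ∈ Ω, 0 < u x) (hneg : ∀ x ∉ Ω, u x ≤ 0) {f g : L2 Ω}
    (hf : f =ᵐ[volume.restrict Ω] fun x => (u x : ℂ))
    (hg : g =ᵐ[volume.restrict Ω] fun x => ((u x - lap u x : ℝ) : ℂ)) :
    resolvent Ω g = f := by
  obtain ⟨U, hU, hU1, hU2⟩ := exists_mem_H10 hΩ hm hu hpos hneg
  have hUf : U.fst = f := Lp.ext (hU1.trans hf.symm)
  -- The weak equation says that a continuous linear functional vanishes, so checking it on test
  -- pairs suffices.
  have hkey : H10 Ω ≤ LinearMap.ker (((innerSL ℂ g).comp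
      (WithLp.fstL 2 ℂ (L2 Ω) (L2Vec Ω)) - innerSL ℂ U :
        WithLp 2 (L2 Ω × L2Vec Ω) →L[ℂ] ℂ) : WithLp 2 (L2 Ω × L2Vec Ω) →ₗ[ℂ] ℂ) := by
    refine Submodule.topologicalClosure_minimal _ (Submodule.span_le.2 ?_)
      (ContinuousLinearMap.isClosed_ker _)
    rintro p ⟨φ, hφ, hc, hs, hp1, hp2⟩
    have hzero : ∀ x ∉ Ω, φ x = 0 := fun x hx => image_eq_zero_of_notMem_tsupport fun h => hx (hs h)
    have hzerog : ∀ x ∉ Ω, grad φ x = 0 := by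
      intro x hx
      have h : fderiv ℝ φ x = 0 := by
        by_contra hne
        exact hx (hs (support_fderiv_subset ℝ hne))
      ext i
      simp [grad, h]
    have hucs : Integrable fun x => (u x : ℂ) * φ x :=
      ((contDiff_ofReal_comp hu).continuous.mul hφ.continuous).integrable_of_hasCompactSupport
        hc.mul_left
    have hlcs : Integrable fun x => (lap u x : ℂ) * φ x :=
      ((Complex.continuous_ofReal.comp (continuous_lap hu)).mul
        hφ.continuous).integrable_of_hasCompactSupport hc.mul_left
    have e1 : inner ℂ g p.fst = ∫ x, ((u x : ℂ) * φ x - (lap u x : ℂ) * φ x) := by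
      rw [L2.inner_def]
      refine Eq.trans (integral_congr_ae ?_)
        (setIntegral_eq_integral_of_forall_compl_eq_zero (s := Ω)
          fun x hx => by rw [hzero x hx]; ring)
      filter_upwards [hg, hp1] with x h1 h2
      rw [h1, h2, RCLike.inner_apply, Complex.conj_ofReal]
      push_cast
      ring
    have e2 : inner ℂ U.fst p.fst = ∫ x, (u x : ℂ) * φ x := by
      rw [L2.inner_def]
      refine Eq.trans (integral_congr_ae ?_)
        (setIntegral_eq_integral_of_forall_compl_eq_zero (s := Ω)
          fun x hx => by rw [hzero x hx]; ring)
      filter_upwards [hU1, hp1] with x h1 h2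
      rw [h1, h2, RCLike.inner_apply, Complex.conj_ofReal]
      ring
    have e3 : inner ℂ U.snd p.snd = -∫ x, (lap u x : ℂ) * φ x := by
      rw [← integral_inner_grad hu hφ hc, L2.inner_def]
      refine Eq.trans (integral_congr_ae ?_)
        (setIntegral_eq_integral_of_forall_compl_eq_zero (s := Ω)
          fun x hx => by rw [hzerog x hx, inner_zero_right])
      filter_upwards [hU2, hp2] with x h1 h2
      rw [h1, h2]
    have e4 : inner ℂ U p = inner ℂ U.fst p.fst + inner ℂ U.snd p.snd := rfl
    have e5 : inner ℂ g p.fst - inner ℂ U p = 0 := by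
      rw [e4, e1, e2, e3, integral_sub hucs hlcs]
      ring
    exact e5
  have hadj : ContinuousLinearMap.adjoint (incl Ω) g = ⟨U, hU⟩ := by
    refine ext_inner_right ℂ fun ψ => ?_
    rw [ContinuousLinearMap.adjoint_inner_left]
    exact sub_eq_zero.1 (hkey ψ.2)
  rw [resolvent, ContinuousLinearMap.comp_apply, hadj]
  exact hUf

/-! ### Explicit solution in the seven-dimensional ball -/

/-- The Laplacian of a radial function. -/
theorem lap_radial {F F' F'' : ℝ → ℝ} (hF : ∀ ρ, HasDerivAt F (F' ρ) ρ)
    (hF' : ∀ ρ, HasDerivAt F' (F'' ρ) ρ) (x : Euc d) :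
    lap (fun y => F (‖y‖ ^ 2)) x = 4 * ‖x‖ ^ 2 * F'' (‖x‖ ^ 2) + 2 * d * F' (‖x‖ ^ 2) := by
  have hn : ∀ y : Euc d, HasFDerivAt (fun y : Euc d => ‖y‖ ^ 2) (2 • innerSL ℝ y) y :=
    fun y => (hasStrictFDerivAt_norm_sq y).hasFDerivAt
  have h1 : ∀ (i : Fin d) (y : Euc d), fderiv ℝ (fun y => F (‖y‖ ^ 2)) y
      (EuclideanSpace.single i 1) = 2 * y i * F' (‖y‖ ^ 2) := by
    intro i y
    have := ((hF (‖y‖ ^ 2)).comp_hasFDerivAt y (hn y)).fderiv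
    simp only [Function.comp_def] at this
    rw [this]
    simp [EuclideanSpace.inner_single_right]
    ring
  have h2 : ∀ i : Fin d, fderiv ℝ (fun y : Euc d => 2 * y i * F' (‖y‖ ^ 2)) x
      (EuclideanSpace.single i 1) =
        4 * (x i) ^ 2 * F'' (‖x‖ ^ 2) + 2 * F' (‖x‖ ^ 2) := by
    intro i
    have hx : HasFDerivAt (fun y : Euc d => 2 * y i)
        ((2 : ℝ) • (EuclideanSpace.proj i : Euc d →L[ℝ] ℝ)) x :=
      (EuclideanSpace.proj (𝕜 := ℝ) i).hasFDerivAt.const_mul 2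
    have := (hx.mul ((hF' (‖x‖ ^ 2)).comp_hasFDerivAt x (hn x))).fderiv
    simp only [Function.comp_def] at this
    refine (congrArg (fun L : Euc d →L[ℝ] ℝ => L (EuclideanSpace.single i 1)) this).trans ?_
    simp [EuclideanSpace.inner_single_right]
    ring
  simp only [lap, h1, h2]
  rw [Finset.sum_add_distrib, ← Finset.sum_mul, ← Finset.mul_sum, EuclideanSpace.norm_sq_eq]
  simp
  ring

/-- The antiderivative of `y⁶` times the radial solution of `Δf = s²f` in dimension `7`. -/
theorem hasDerivAt_pow_mul_coshSqrt (s y : ℝ) :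
    HasDerivAt (fun y => 2 * y ^ 7 * coshSqrt 4 (s ^ 2 * y ^ 2))
      (y ^ 6 * coshSqrt 3 (s ^ 2 * y ^ 2)) y := by
  have h1 : HasDerivAt (fun y : ℝ => s ^ 2 * y ^ 2) (s ^ 2 * (2 * y)) y := by
    simpa using (hasDerivAt_pow 2 y).const_mul (s ^ 2)
  have h2 := (((hasDerivAt_pow 7 y).const_mul 2).mul
    ((hasDerivAt_coshSqrt 4 (s ^ 2 * y ^ 2)).comp y h1))
  refine h2.congr_deriv ?_
  -- For `m = 3` the recurrence has the factor `4m + 2 = 14 = 2 · 7`, which is what differentiating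
  -- `2y⁷` produces.
  rw [← coshSqrt_rec 3]
  push_cast
  simp only [Function.comp_def]
  ring

theorem measureReal_ball_pos {d : ℕ} {R : ℝ} (hR : 0 < R) :
    0 < (volume : Measure (Euc d)).real (Metric.ball 0 R) :=
  ENNReal.toReal_pos (Metric.measure_ball_pos _ _ hR).ne' measure_ball_lt_top.ne

/-- In polar coordinates the mean is `7 R⁻⁷ ∫₀ᴿ y⁶ f(s²y²) dy`, and the antiderivative at `R`
contributes `2R⁷`. -/
theorem average_ball_coshSqrt {R : ℝ} (hR : 0 < R) (s : ℝ) :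
    ⨍ x in Metric.ball (0 : Euc 7) R, coshSqrt 3 (s ^ 2 * ‖x‖ ^ 2) =
      14 * coshSqrt 4 (s ^ 2 * R ^ 2) := by
  have h1 : ∫ x in Metric.ball (0 : Euc 7) R, coshSqrt 3 (s ^ 2 * ‖x‖ ^ 2) =
      ∫ x : Euc 7, (Set.Iio R).indicator (fun y => coshSqrt 3 (s ^ 2 * y ^ 2)) ‖x‖ := by
    rw [← integral_indicator measurableSet_ball]
    congr 1
    funext x
    simp [Set.indicator]
  have h2 : ∫ y in Set.Ioi (0 : ℝ),
      y ^ 6 • (Set.Iio R).indicator (fun y => coshSqrt 3 (s ^ 2 * y ^ 2)) y =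
        2 * R ^ 7 * coshSqrt 4 (s ^ 2 * R ^ 2) := by
    have h3 : ∀ y : ℝ, y ^ 6 • (Set.Iio R).indicator (fun y => coshSqrt 3 (s ^ 2 * y ^ 2)) y =
        (Set.Iio R).indicator (fun y => y ^ 6 * coshSqrt 3 (s ^ 2 * y ^ 2)) y := by
      intro y
      by_cases hy : y ∈ Set.Iio R <;> simp [Set.indicator, hy]
    simp_rw [h3]
    rw [setIntegral_indicator measurableSet_Iio, Set.Ioi_inter_Iio,
      ← integral_Ioc_eq_integral_Ioo, ← intervalIntegral.integral_of_le hR.le,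
      intervalIntegral.integral_eq_sub_of_hasDerivAt
        fun y _ => hasDerivAt_pow_mul_coshSqrt s y]
    · simp
    · refine Continuous.intervalIntegrable ?_ _ _
      have := (contDiff_coshSqrt 3).continuous
      fun_prop
  have hb : (volume : Measure (Euc 7)).real (Metric.ball 0 R) =
      R ^ 7 * (volume : Measure (Euc 7)).real (Metric.ball 0 1) := by
    rw [measureReal_def, Measure.addHaar_ball _ _ hR.le, ENNReal.toReal_mul,
      ENNReal.toReal_ofReal (by positivity), measureReal_def]
    simp
  have hpos : 0 < (volume : Measure (Euc 7)).real (Metric.ball 0 1) :=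
    measureReal_ball_pos one_pos
  rw [setAverage_eq, h1, integral_fun_norm_addHaar, hb]
  simp only [finrank_euclideanSpace, Fintype.card_fin, Nat.reduceSub, nsmul_eq_mul]
  rw [h2]
  simp only [smul_eq_mul]
  field_simp
  ring

/-- The radial Laplacian `4ρF'' + 2dF'` matches the recurrence exactly when `2d = 4m + 2`, so `d =
7` forces `m = 3`. The constant 1 and division by the boundary value `D` give the inhomogeneous
equation and the zero boundary values. -/
theorem heatContentLaplace_ball_seven {R s : ℝ} (hR : 0 < R) (hs : 0 < s) :
    heatContentLaplace (Metric.ball (0 : Euc 7) R) s =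
      (1 - 14 * coshSqrt 4 (s ^ 2 * R ^ 2) / coshSqrt 3 (s ^ 2 * R ^ 2)) / s ^ 2 := by
  set D := coshSqrt 3 (s ^ 2 * R ^ 2) with hD
  have hDpos : 0 < D := coshSqrt_pos 3 (by positivity)
  have hs2 : 0 < s ^ 2 := by positivity
  let F : ℕ → ℝ → ℝ := fun m ρ => coshSqrt (3 + m) (s ^ 2 * ρ)
  have hF : ∀ m ρ, HasDerivAt (F m) (s ^ 2 * F (m + 1) ρ) ρ := by
    intro m ρ
    have h := (hasDerivAt_coshSqrt (3 + m) (s ^ 2 * ρ)).comp ρ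
      ((hasDerivAt_id ρ).const_mul (s ^ 2))
    refine h.congr_deriv ?_
    simp [F, add_assoc, mul_comm]
  let G : ℝ → ℝ := fun ρ => (1 - F 0 ρ / D) / s ^ 2
  have hG : ∀ ρ, HasDerivAt G (-F 1 ρ / D) ρ := by
    intro ρ
    refine ((((hF 0 ρ).div_const D).const_sub 1).div_const (s ^ 2)).congr_deriv ?_
    field_simp
  have hG' : ∀ ρ, HasDerivAt (fun ρ => -F 1 ρ / D) (-(s ^ 2 * F 2 ρ) / D) ρ := fun ρ =>
    (hF 1 ρ).neg.div_const D
  let u : Euc 7 → ℝ := fun x => G (‖x‖ ^ 2)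
  have hu : ContDiff ℝ ∞ u := by
    have hGs : ContDiff ℝ ∞ G :=
      (contDiff_const.sub (((contDiff_coshSqrt 3).comp
        (contDiff_const.mul contDiff_id)).div_const D)).div_const _
    exact hGs.comp (contDiff_norm_sq ℝ)
  have hmono : ∀ x : Euc 7, 0 ≤ s ^ 2 * ‖x‖ ^ 2 := fun x => by positivity
  have hR2 : 0 ≤ s ^ 2 * R ^ 2 := by positivity
  have hpos : ∀ x ∈ Metric.ball (0 : Euc 7) R, 0 < u x := by
    intro x hx
    rw [mem_ball_zero_iff] at hx
    have h : coshSqrt 3 (s ^ 2 * ‖x‖ ^ 2) < D :=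
      coshSqrt_strictMonoOn 3 (hmono x) hR2 (by gcongr)
    exact div_pos (sub_pos.2 ((div_lt_one hDpos).2 h)) hs2
  have hneg : ∀ x ∉ Metric.ball (0 : Euc 7) R, u x ≤ 0 := by
    intro x hx
    rw [mem_ball_zero_iff, not_lt] at hx
    have h : D ≤ coshSqrt 3 (s ^ 2 * ‖x‖ ^ 2) :=
      (coshSqrt_strictMonoOn 3).monotoneOn hR2 (hmono x) (by gcongr)
    exact div_nonpos_of_nonpos_of_nonneg (sub_nonpos.2 ((one_le_div hDpos).2 h)) hs2.le
  have hlap : ∀ x, 1 - (s ^ 2 - 1) * u x = u x - lap u x := by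
    intro x
    have h1 : lap u x = _ := lap_radial hG hG' x
    have h2 := coshSqrt_rec 3 (s ^ 2 * ‖x‖ ^ 2)
    rw [h1]
    simp only [u, G, F, add_zero, Nat.reduceAdd] at h2 ⊢
    rw [← h2]
    push_cast
    field_simp
    ring
  have hbd : Bornology.IsBounded (Metric.ball (0 : Euc 7) R) := Metric.isBounded_ball
  have hL : MemLp (fun x => (u x : ℂ)) 2 (volume.restrict (Metric.ball (0 : Euc 7) R)) :=
    memLp_of_continuous hbd measurableSet_ball (contDiff_ofReal_comp hu).continuous
  have hres := resolvent_apply_eq hbd measurableSet_ball hu hpos hneg hL.coeFn_toLp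
    (g := Lp.const 2 (volume.restrict (Metric.ball (0 : Euc 7) R)) (1 : ℂ) -
      ((s ^ 2 - 1 : ℝ) : ℂ) • hL.toLp _) (by
    filter_upwards [Lp.coeFn_sub (Lp.const 2 (volume.restrict (Metric.ball (0 : Euc 7) R)) (1 : ℂ))
        (((s ^ 2 - 1 : ℝ) : ℂ) • hL.toLp _),
      Lp.coeFn_const (p := 2) (μ := volume.restrict (Metric.ball (0 : Euc 7) R)) (1 : ℂ),
      Lp.coeFn_smul ((s ^ 2 - 1 : ℝ) : ℂ) (hL.toLp _), hL.coeFn_toLp] with x h1 h2 h3 h4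
    rw [h1, Pi.sub_apply, h2, h3, Pi.smul_apply, h4, ← hlap x]
    simp)
  rw [heatContentLaplace_eq_average hs hres]
  have h5 : ⨍ x in Metric.ball (0 : Euc 7) R, (hL.toLp _ x).re =
      ⨍ x in Metric.ball (0 : Euc 7) R, u x := by
    refine average_congr ?_
    filter_upwards [hL.coeFn_toLp] with x hx
    rw [hx, Complex.ofReal_re]
  rw [h5]
  have hint : IntegrableOn (fun x : Euc 7 => coshSqrt 3 (s ^ 2 * ‖x‖ ^ 2))
      (Metric.ball (0 : Euc 7) R) := by
    refine (ContinuousOn.integrableOn_compact (isCompact_closedBall (0 : Euc 7) R)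
      (Continuous.continuousOn ?_)).mono_set Metric.ball_subset_closedBall
    have := (contDiff_coshSqrt 3).continuous
    fun_prop
  have hball : 0 < (volume : Measure (Euc 7)).real (Metric.ball 0 R) :=
    measureReal_ball_pos hR
  have havg := average_ball_coshSqrt hR s
  rw [setAverage_eq, smul_eq_mul] at havg ⊢
  have h6 : ∫ x in Metric.ball (0 : Euc 7) R, u x =
      ((volume : Measure (Euc 7)).real (Metric.ball 0 R) -
        (∫ x in Metric.ball (0 : Euc 7) R, coshSqrt 3 (s ^ 2 * ‖x‖ ^ 2)) / D) / s ^ 2 := by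
    have h7 : ∫ x in Metric.ball (0 : Euc 7) R, u x = ∫ x in Metric.ball (0 : Euc 7) R,
        (1 - coshSqrt 3 (s ^ 2 * ‖x‖ ^ 2) / D) / s ^ 2 := rfl
    rw [h7, integral_div, integral_sub (integrable_const _) (hint.div_const D), integral_div]
    simp
  rw [h6, ← havg]
  field_simp

/-! ### Asymptotic series in `1/s` -/

/-- Dropping the last term `c (N+1) / s^(N+1)` costs only `o(s^(-N))`, so orders can be descended
one at a time. -/
theorem IsWeylSeries.of_eventually {F : ℝ → ℝ} {c : ℕ → ℝ} {N₀ : ℕ}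
    (h : ∀ N, N₀ ≤ N → (fun s : ℝ => F s - ∑ n ∈ Finset.Icc 2 N, c n / s ^ n) =o[atTop]
      fun s : ℝ => 1 / s ^ N) : IsWeylSeries F c := by
  have hstep : ∀ N : ℕ, ((fun s : ℝ => F s - ∑ n ∈ Finset.Icc 2 (N + 1), c n / s ^ n) =o[atTop]
      fun s : ℝ => 1 / s ^ (N + 1)) → (fun s : ℝ => F s - ∑ n ∈ Finset.Icc 2 N, c n / s ^ n)
        =o[atTop] fun s : ℝ => 1 / s ^ N := by
    intro N hN
    have h1 : (fun s : ℝ => 1 / s ^ (N + 1)) =o[atTop] fun s : ℝ => 1 / s ^ N := by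
      refine (isLittleO_iff_tendsto' ?_).2 ?_
      · filter_upwards [eventually_gt_atTop 0] with s hs h0
        exact absurd h0 (by positivity)
      · refine tendsto_inv_atTop_zero.congr' ?_
        filter_upwards [eventually_gt_atTop 0] with s hs
        field_simp
        ring
    have h2 : (fun s : ℝ => ∑ n ∈ Finset.Icc 2 (N + 1), c n / s ^ n -
        ∑ n ∈ Finset.Icc 2 N, c n / s ^ n) =o[atTop] fun s : ℝ => 1 / s ^ N := by
      rcases le_or_gt 2 (N + 1) with hN2 | hN2
      · refine (h1.const_mul_left (c (N + 1))).congr_left fun s => ?_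
        rw [Finset.sum_Icc_succ_top hN2]
        ring
      · rw [Finset.Icc_eq_empty (by omega), Finset.Icc_eq_empty (by omega)]
        simp
    exact ((hN.trans h1).add h2).congr_left fun s => by ring
  intro N
  obtain ⟨k, hk⟩ : ∃ k, N₀ ≤ N + k := ⟨N₀, by omega⟩
  induction k generalizing N with
  | zero => exact h N hk
  | succ k ih => exact hstep N (ih (N + 1) (by omega))

/-- Once the lower coefficients agree, the two partial sums differ by one term, which would have to
be `o` of its own order. -/
theorem IsWeylSeries.unique {F : ℝ → ℝ} {c c' : ℕ → ℝ} (h : IsWeylSeries F c)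
    (h' : IsWeylSeries F c') {n : ℕ} (hn : 2 ≤ n) : c n = c' n := by
  induction n using Nat.strong_induction_on with
  | _ n ih =>
    obtain ⟨m, rfl⟩ : ∃ m, n = m + 1 := ⟨n - 1, by omega⟩
    have h1 : (fun s : ℝ => (c' (m + 1) - c (m + 1)) * (1 / s ^ (m + 1))) =o[atTop]
        fun s : ℝ => 1 / s ^ (m + 1) := by
      refine ((h (m + 1)).sub (h' (m + 1))).congr_left fun s => ?_
      rw [Finset.sum_Icc_succ_top hn, Finset.sum_Icc_succ_top hn]
      have : ∑ k ∈ Finset.Icc 2 m, c k / s ^ k = ∑ k ∈ Finset.Icc 2 m, c' k / s ^ k :=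
        Finset.sum_congr rfl fun k hk => by
          rw [Finset.mem_Icc] at hk
          rw [ih k (by omega) hk.1]
      rw [this]
      ring
    have h2 := h1.tendsto_div_nhds_zero
    have h3 : Tendsto (fun _ : ℝ => c' (m + 1) - c (m + 1)) atTop (𝓝 0) := by
      refine h2.congr' ?_
      filter_upwards [eventually_gt_atTop 0] with s hs
      field_simp
    linarith [tendsto_nhds_unique h3 tendsto_const_nhds]

/-! ### Expansion of the rational part -/

/-- The sequence `3^(n/2 - 2) (cos (nπ/6) - √3 sin (nπ/6))` in amplitude-phase form. -/
noncomputable def wave (n : ℕ) : ℝ := 2 / 9 * √3 ^ n * Real.cos ((n + 2) * Real.pi / 6)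

/-- `√3 e^(±iπ/6)` are the roots of `x² - 3x + 3`. -/
theorem wave_add_two (n : ℕ) : wave (n + 2) = 3 * wave (n + 1) - 3 * wave n := by
  unfold wave
  have h3 : √3 * √3 = 3 := Real.mul_self_sqrt (by norm_num)
  set θ : ℝ := (n + 2) * Real.pi / 6 with hθ
  have e2 : (((n + 2 : ℕ) : ℝ) + 2) * Real.pi / 6 = θ + Real.pi / 3 := by
    rw [hθ]; push_cast; ring
  have e1 : (((n + 1 : ℕ) : ℝ) + 2) * Real.pi / 6 = θ + Real.pi / 6 := by
    rw [hθ]; push_cast; ring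
  rw [e2, e1, Real.cos_add, Real.cos_add, Real.cos_pi_div_three, Real.sin_pi_div_three,
    Real.cos_pi_div_six, Real.sin_pi_div_six, pow_succ, pow_succ]
  linear_combination (2 / 9 * √3 ^ n) *
    ((1 / 2 * Real.cos θ - √3 / 2 * Real.sin θ) - 3 / 2 * Real.cos θ) * h3

theorem wave_three : wave 3 = -1 := by
  have h3 : √3 * √3 = 3 := Real.mul_self_sqrt (by norm_num)
  have e : (((3 : ℕ) : ℝ) + 2) * Real.pi / 6 = Real.pi - Real.pi / 6 := by push_cast; ring
  rw [wave, e, Real.cos_pi_sub, Real.cos_pi_div_six]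
  linear_combination (-1 / 9 * √3 ^ 2 - 1 / 3) * h3

theorem wave_four : wave 4 = -2 := by
  have h3 : √3 * √3 = 3 := Real.mul_self_sqrt (by norm_num)
  have e : (((4 : ℕ) : ℝ) + 2) * Real.pi / 6 = Real.pi := by push_cast; ring
  rw [wave, e, Real.cos_pi]
  linear_combination (-2 / 9 * √3 ^ 2 - 2 / 3) * h3

theorem one_sub_three_mul_add_pos (v : ℝ) : 0 < 1 - 3 * v + 3 * v ^ 2 := by
  nlinarith [sq_nonneg (2 * v - 1)]

/-- The Taylor expansion of `(1 - v) / (1 - 3v + 3v²)` with explicit remainder. -/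
theorem rational_taylor (v : ℝ) (K : ℕ) :
    (1 - v) / (1 - 3 * v + 3 * v ^ 2) = -∑ k ∈ Finset.range K, wave (k + 3) * v ^ k -
      v ^ K * ((wave (K + 3) + (wave (K + 4) - 3 * wave (K + 3)) * v) /
        (1 - 3 * v + 3 * v ^ 2)) := by
  have hq := (one_sub_three_mul_add_pos v).ne'
  induction K with
  | zero =>
    simp only [Finset.range_zero, Finset.sum_empty, zero_add, wave_three, wave_four]
    field_simp
    ring
  | succ K ih =>
    have hw : wave (K + 1 + 4) = 3 * wave (K + 4) - 3 * wave (K + 3) := wave_add_two (K + 3)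
    rw [ih, Finset.sum_range_succ, hw, show K + 1 + 3 = K + 4 by ring]
    generalize ∑ k ∈ Finset.range K, wave (k + 3) * v ^ k = S
    field_simp
    ring

/-- The ratio of the radial solutions, up to an exponentially small term. -/
theorem coshSqrt_ratio {z : ℝ} (hz : 0 < z) :
    14 * coshSqrt 4 (z ^ 2) / coshSqrt 3 (z ^ 2) =
      7 * z⁻¹ * (-5 * z⁻¹ + (1 - z⁻¹) / (1 - 3 * z⁻¹ + 3 * z⁻¹ ^ 2)) +
      7 / 8 * z⁻¹ ^ 4 * (Real.exp (-z) /
        (coshSqrt 3 (z ^ 2) * (1 - 3 * z⁻¹ + 3 * z⁻¹ ^ 2))) := by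
  have h3 := coshSqrt_three_sq z
  have h4 := coshSqrt_four_sq z
  rw [← Real.cosh_sub_sinh]
  have hX : 0 < coshSqrt 3 (z ^ 2) := coshSqrt_pos 3 (by positivity)
  have hq := one_sub_three_mul_add_pos z⁻¹
  have hq' : 0 < z ^ 2 - 3 * z + 3 := by nlinarith [sq_nonneg (2 * z - 3)]
  obtain ⟨Q, hQ⟩ : ∃ Q, Q = z ^ 2 - 3 * z + 3 := ⟨_, rfl⟩
  have hqe : 1 - 3 * z⁻¹ + 3 * z⁻¹ ^ 2 = Q / z ^ 2 := by
    rw [hQ]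
    field_simp
  rw [← hQ] at hq'
  rw [hqe]
  set X := coshSqrt 3 (z ^ 2)
  set Y := coshSqrt 4 (z ^ 2)
  -- The multipliers `z² - 3z + 3` and `z³ - 6z² + 15z - 15` are the coefficients of `e^z/2` in the
  -- closed forms for `X` and `Y`. Cross-multiplying cancels `e^z` and leaves only `cosh z - sinh z
  -- = e^(-z)`.
  have hkey : 16 * z ^ 2 * Q * Y =
      8 * (z ^ 3 - z ^ 2 - 5 * Q) * X + (Real.cosh z - Real.sinh z) := by
    rw [hQ]
    refine mul_left_cancel₀ (pow_pos hz 5).ne' ?_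
    linear_combination (z ^ 2 - 3 * z + 3) * h4 - (z ^ 3 - 6 * z ^ 2 + 15 * z - 15) * h3
  field_simp
  linear_combination 7 * hkey

/-- The coefficients of the Weyl series of the seven-dimensional ball. -/
noncomputable def ballCoeff (R : ℝ) (n : ℕ) : ℝ :=
  if n = 2 then 1 else if n = 4 then 21 / R ^ 2 else 7 / R ^ (n - 2) * wave n

theorem ballCoeff_of_five_le (R : ℝ) {n : ℕ} (hn : 5 ≤ n) :
    ballCoeff R n = 7 / R ^ (n - 2) * wave n := by
  rw [ballCoeff, if_neg (by omega), if_neg (by omega)]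

/-- The Taylor term `v^k` contributes at `n = k + 3`, hence `K + 2` terms up to `n = K + 4`. The
extra `35 v²` is felt only at `n = 4`, where `35 + 7 · wave 4 = 21`; from `n = 5` on the pattern is
regular. -/
theorem sum_ballCoeff {R s : ℝ} (hR : 0 < R) (hs : 0 < s) (K : ℕ) :
    ∑ n ∈ Finset.Icc 2 (K + 4), ballCoeff R n / s ^ n =
      (1 + 35 * (s * R)⁻¹ ^ 2 + 7 * (s * R)⁻¹ *
        ∑ k ∈ Finset.range (K + 2), wave (k + 3) * (s * R)⁻¹ ^ k) / s ^ 2 := by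
  induction K with
  | zero =>
    have : Finset.Icc 2 (0 + 4) = {2, 3, 4} := rfl
    rw [this]
    simp [ballCoeff, Finset.sum_range_succ, wave_three, wave_four]
    field_simp
    ring
  | succ K ih =>
    rw [show K + 1 + 4 = K + 4 + 1 by ring, Finset.sum_Icc_succ_top (by omega), ih,
      show K + 1 + 2 = K + 2 + 1 by ring, Finset.sum_range_succ _ (K + 2),
      ballCoeff_of_five_le R (by omega), show K + 4 + 1 - 2 = K + 3 by omega,
      show K + 2 + 3 = K + 4 + 1 by ring]
    generalize ∑ k ∈ Finset.range (K + 2), wave (k + 3) * (s * R)⁻¹ ^ k = S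
    simp only [inv_pow]
    field_simp
    ring

theorem isWeylSeries_ballCoeff {R : ℝ} (hR : 0 < R) :
    IsWeylSeries (heatContentLaplace (Metric.ball (0 : Euc 7) R)) (ballCoeff R) := by
  refine IsWeylSeries.of_eventually (N₀ := 4) fun N hN => ?_
  obtain ⟨K, rfl⟩ : ∃ K, N = K + 4 := ⟨N - 4, by omega⟩
  have hv : Tendsto (fun s : ℝ => (s * R)⁻¹) atTop (𝓝 0) :=
    tendsto_inv_atTop_zero.comp (tendsto_id.atTop_mul_const hR)
  have hq : Tendsto (fun s : ℝ => 1 - 3 * (s * R)⁻¹ + 3 * (s * R)⁻¹ ^ 2) atTop (𝓝 1) := by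
    simpa using ((hv.const_mul 3).const_sub 1).add ((hv.pow 2).const_mul 3)
  -- the two error terms, multiplied by `s ^ (K + 4)`
  have h1 : Tendsto (fun s : ℝ => 7 / R ^ (K + 3) * s⁻¹ *
      ((wave (K + 2 + 3) + (wave (K + 2 + 4) - 3 * wave (K + 2 + 3)) * (s * R)⁻¹) /
        (1 - 3 * (s * R)⁻¹ + 3 * (s * R)⁻¹ ^ 2))) atTop (𝓝 0) := by
    simpa using (tendsto_inv_atTop_zero.const_mul (7 / R ^ (K + 3))).mul
      (((hv.const_mul (wave (K + 2 + 4) - 3 * wave (K + 2 + 3))).const_add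
        (wave (K + 2 + 3))).div hq one_ne_zero)
  have h2 : Tendsto (fun s : ℝ => s ^ (K + 2) * (7 / 8 * (s * R)⁻¹ ^ 4 *
      (Real.exp (-(s * R)) / (coshSqrt 3 ((s * R) ^ 2) *
        (1 - 3 * (s * R)⁻¹ + 3 * (s * R)⁻¹ ^ 2))))) atTop (𝓝 0) := by
    have hz : Tendsto (fun s : ℝ => (s * R) ^ (K + 2) * Real.exp (-(s * R))) atTop (𝓝 0) :=
      (Real.tendsto_pow_mul_exp_neg_atTop_nhds_zero (K + 2)).comp
        (tendsto_id.atTop_mul_const hR)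
    -- The denominator needs no growth: being bounded below by its value at 0, it leaves the decay
    -- to `e^(-z)`.
    have hX0 : 0 < coshSqrt 3 0 := coshSqrt_pos 3 le_rfl
    have hX : ∀ s : ℝ, |(coshSqrt 3 ((s * R) ^ 2))⁻¹| ≤ (coshSqrt 3 0)⁻¹ := by
      intro s
      have h : coshSqrt 3 0 ≤ coshSqrt 3 ((s * R) ^ 2) :=
        (coshSqrt_strictMonoOn 3).monotoneOn Set.self_mem_Ici (sq_nonneg (s * R)) (sq_nonneg _)
      rw [abs_of_pos (inv_pos.2 (hX0.trans_le h))]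
      exact inv_anti₀ hX0 h
    have h0 : Tendsto (fun s : ℝ => (s * R) ^ (K + 2) * Real.exp (-(s * R)) / R ^ (K + 2) *
        (7 / 8 * (s * R)⁻¹ ^ 4) / (1 - 3 * (s * R)⁻¹ + 3 * (s * R)⁻¹ ^ 2)) atTop (𝓝 0) := by
      simpa [Pi.div_def] using ((hz.div_const (R ^ (K + 2))).mul ((hv.pow 4).const_mul (7 / 8))).div hq
        one_ne_zero
    refine (h0.zero_mul_isBoundedUnder_le (g := fun s : ℝ => (coshSqrt 3 ((s * R) ^ 2))⁻¹)
      (isBoundedUnder_of ⟨_, hX⟩)).congr fun s => ?_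
    rw [mul_pow, mul_comm (coshSqrt 3 _), ← div_div]
    generalize 1 - 3 * (s * R)⁻¹ + 3 * (s * R)⁻¹ ^ 2 = Q
    field_simp
  refine (isLittleO_iff_tendsto' ?_).2 ?_
  · filter_upwards [eventually_gt_atTop 0] with s hs h0
    exact absurd h0 (by positivity)
  · have h3 := h1.sub h2
    rw [sub_zero] at h3
    refine h3.congr' ?_
    filter_upwards [eventually_gt_atTop 0] with s hs
    have hz : 0 < s * R := mul_pos hs hR
    rw [heatContentLaplace_ball_seven hR hs, ← mul_pow, coshSqrt_ratio hz,
      rational_taylor _ (K + 2), sum_ballCoeff hR hs]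
    generalize ∑ k ∈ Finset.range (K + 2), wave (k + 3) * (s * R)⁻¹ ^ k = S
    generalize Real.exp (-(s * R)) / (coshSqrt 3 ((s * R) ^ 2) *
        (1 - 3 * (s * R)⁻¹ + 3 * (s * R)⁻¹ ^ 2)) = E
    generalize (wave (K + 2 + 3) + (wave (K + 2 + 4) - 3 * wave (K + 2 + 3)) * (s * R)⁻¹) /
        (1 - 3 * (s * R)⁻¹ + 3 * (s * R)⁻¹ ^ 2) = T
    simp only [inv_pow]
    field_simp
    ring

/-! ### Roots and partial fractions of `1 - 3v + 3v²` -/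

theorem v₁_eq : v₁ = ⟨1 / 2, √3 / 6⟩ := by
  have h3 : √3 * √3 = 3 := Real.mul_self_sqrt (by norm_num)
  have e : Complex.I * Real.pi / 6 = ((Real.pi / 6 : ℝ) : ℂ) * Complex.I := by push_cast; ring
  have hi : (√3)⁻¹ = √3 / 3 := by
    field_simp
    linarith
  rw [v₁, e, Complex.exp_mul_I, ← Complex.ofReal_cos, ← Complex.ofReal_sin,
    Real.cos_pi_div_six, Real.sin_pi_div_six, hi]
  apply Complex.ext
  · simp [-Complex.ofReal_div]
    linarith
  · simp [-Complex.ofReal_div]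
    ring

theorem v₂_eq : v₂ = ⟨1 / 2, -(√3 / 6)⟩ := by
  have h3 : √3 * √3 = 3 := Real.mul_self_sqrt (by norm_num)
  have e : -(Complex.I * Real.pi / 6) = ((-(Real.pi / 6) : ℝ) : ℂ) * Complex.I := by
    push_cast; ring
  have hi : (√3)⁻¹ = √3 / 3 := by
    field_simp
    linarith
  rw [v₂, e, Complex.exp_mul_I, ← Complex.ofReal_cos, ← Complex.ofReal_sin, Real.cos_neg,
    Real.sin_neg, Real.cos_pi_div_six, Real.sin_pi_div_six, hi]
  apply Complex.ext
  · simp [-Complex.ofReal_div]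
    linarith
  · simp [-Complex.ofReal_div]
    ring

theorem v₁_add_v₂ : v₁ + v₂ = 1 := by
  rw [v₁_eq, v₂_eq]
  apply Complex.ext <;> norm_num

theorem v₁_mul_v₂ : 3 * (v₁ * v₂) = 1 := by
  have h3 : √3 * √3 = 3 := Real.mul_self_sqrt (by norm_num)
  rw [v₁_eq, v₂_eq]
  apply Complex.ext
  · simp
    linarith
  · simp
    ring

theorem v₁_sub_v₂_ne_zero : v₁ - v₂ ≠ 0 := by
  rw [sub_ne_zero, v₁_eq, v₂_eq]
  intro h
  have h1 := congrArg Complex.im h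
  have h3 : 0 < √3 := by positivity
  simp only at h1
  linarith

theorem norm_v₁ : ‖v₁‖ = 1 / √3 := by
  have e : Complex.I * Real.pi / 6 = ((Real.pi / 6 : ℝ) : ℂ) * Complex.I := by push_cast; ring
  rw [v₁, e, norm_mul, Complex.norm_exp_ofReal_mul_I, Complex.norm_real, mul_one,
    Real.norm_of_nonneg (by positivity), one_div]

theorem norm_v₂ : ‖v₂‖ = 1 / √3 := by
  have e : -(Complex.I * Real.pi / 6) = ((-(Real.pi / 6) : ℝ) : ℂ) * Complex.I := by
    push_cast; ring
  rw [v₂, e, norm_mul, Complex.norm_exp_ofReal_mul_I, Complex.norm_real, mul_one,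
    Real.norm_of_nonneg (by positivity), one_div]

theorem quadratic_factor (v : ℂ) : 1 - 3 * v + 3 * v ^ 2 = 3 * ((v - v₁) * (v - v₂)) := by
  linear_combination (-1 : ℂ) * v₁_mul_v₂ + 3 * v * v₁_add_v₂

theorem quadratic_eq_zero_iff (v : ℂ) : 1 - 3 * v + 3 * v ^ 2 = 0 ↔ v = v₁ ∨ v = v₂ := by
  rw [quadratic_factor]
  simp [sub_eq_zero]

theorem partial_fraction {v : ℂ} (h1 : v ≠ v₁) (h2 : v ≠ v₂) :
    1 / (1 - 3 * v + 3 * v ^ 2) =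
      1 / (3 * (v₁ - v₂)) * (1 / (v - v₁) - 1 / (v - v₂)) := by
  have h1' := sub_ne_zero.2 h1
  have h2' := sub_ne_zero.2 h2
  have h3 := v₁_sub_v₂_ne_zero
  rw [quadratic_factor]
  field_simp
  ring

theorem hasSum_pow_div_pow_succ {v w : ℂ} (h : ‖v‖ < ‖w‖) :
    HasSum (fun k : ℕ => v ^ k * (1 / w ^ (k + 1))) (1 / (w - v)) := by
  have hw : w ≠ 0 := norm_pos_iff.1 ((norm_nonneg v).trans_lt h)
  have hlt : ‖v / w‖ < 1 := by
    rw [norm_div]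
    exact (div_lt_one (norm_pos_iff.2 hw)).2 h
  have hne : w - v ≠ 0 := by
    rw [sub_ne_zero]
    rintro rfl
    exact lt_irrefl _ h
  have hs := (hasSum_geometric_of_norm_lt_one hlt).mul_left (1 / w)
  have e : 1 / w * (1 - v / w)⁻¹ = 1 / (w - v) := by
    have : 1 - v / w = (w - v) / w := by field_simp
    rw [this]
    field_simp
  rw [e] at hs
  refine hs.congr_fun fun k => ?_
  rw [div_pow, pow_succ]
  field_simp

theorem hasSum_quadratic_inv {v : ℂ} (hv : ‖v‖ < 1 / √3) :
    HasSum (fun k : ℕ => v ^ k / (3 * (v₁ - v₂)) * (1 / v₂ ^ (k + 1) - 1 / v₁ ^ (k + 1)))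
      (1 / (1 - 3 * v + 3 * v ^ 2)) := by
  have h1 : v ≠ v₁ := by rintro rfl; exact absurd hv (by rw [norm_v₁]; exact lt_irrefl _)
  have h2 : v ≠ v₂ := by rintro rfl; exact absurd hv (by rw [norm_v₂]; exact lt_irrefl _)
  have hs := ((hasSum_pow_div_pow_succ (hv.trans_eq norm_v₂.symm)).sub
    (hasSum_pow_div_pow_succ (hv.trans_eq norm_v₁.symm))).mul_left (1 / (3 * (v₁ - v₂)))
  have e : 1 / (3 * (v₁ - v₂)) * (1 / (v₂ - v) - 1 / (v₁ - v)) =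
      1 / (1 - 3 * v + 3 * v ^ 2) := by
    rw [partial_fraction h1 h2, ← neg_sub v v₂, ← neg_sub v v₁]
    simp only [one_div, inv_neg]
    ring
  rw [e] at hs
  refine hs.congr_fun fun k => ?_
  ring

/-! ### Size and periodicity of the coefficients -/

theorem wave_eq (n : ℕ) : wave n = (3 : ℝ) ^ ((n : ℝ) / 2 - 2) *
    (Real.cos (n * Real.pi / 6) - √3 * Real.sin (n * Real.pi / 6)) := by
  have e : ((n : ℝ) + 2) * Real.pi / 6 = n * Real.pi / 6 + Real.pi / 3 := by ring
  have h : (3 : ℝ) ^ ((n : ℝ) / 2 - 2) = √3 ^ n / 9 := by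
    rw [Real.rpow_sub (by norm_num), Real.sqrt_eq_rpow, ← Real.rpow_natCast, ← Real.rpow_mul
      (by norm_num), one_div_mul_eq_div]
    norm_num
  rw [wave, h, e, Real.cos_add, Real.cos_pi_div_three, Real.sin_pi_div_three]
  ring

/-- Removing the geometric factor leaves a pure cosine of amplitude `7 · (2/9) · 3 = 14/3`, the
source of the bound and of the period. -/
theorem wave_rescaled {n : ℕ} (hn : 2 ≤ n) :
    7 * wave n / √3 ^ (n - 2) = 14 / 3 * Real.cos ((n + 2) * Real.pi / 6) := by
  have h3 : √3 ^ 2 = 3 := Real.sq_sqrt (by norm_num)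
  have hp : √3 ^ n = 3 * √3 ^ (n - 2) := by
    calc √3 ^ n = √3 ^ (2 + (n - 2)) := by congr 1; omega
      _ = 3 * √3 ^ (n - 2) := by rw [pow_add, h3]
  have hpos : 0 < √3 ^ (n - 2) := by positivity
  rw [wave, hp]
  field_simp
  ring

theorem cos_add_twelve (n : ℕ) :
    Real.cos (((n + 12 : ℕ) + 2) * Real.pi / 6) = Real.cos ((n + 2) * Real.pi / 6) := by
  rw [← Real.cos_add_two_pi ((n + 2) * Real.pi / 6)]
  congr 1
  push_cast; ring

/-- Geometric growth is negligible against the growth of the Gamma function. -/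
theorem isLittleO_pow_Gamma (A β : ℝ) {l : ℝ} (hl : 0 < l) :
    (fun n : ℕ => A ^ (n - 2)) =o[atTop] fun n : ℕ => Real.Gamma (n - β + 1) / l ^ (n - 2) := by
  -- Rounding `β` up to an integer compares Gamma with a factorial; the margin 2 keeps both
  -- arguments in `[2, ∞)`, where Gamma increases.
  have hΓ : ∀ n : ℕ, ⌈|β|⌉₊ + 2 ≤ n → ((n - ⌈|β|⌉₊).factorial : ℝ) ≤ Real.Gamma (n - β + 1) := by
    intro n hn
    have hb : β ≤ ⌈|β|⌉₊ := (le_abs_self β).trans (Nat.le_ceil _)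
    have hn' : ((⌈|β|⌉₊ : ℕ) : ℝ) + 2 ≤ n := by exact_mod_cast hn
    rw [← Real.Gamma_nat_eq_factorial, Nat.cast_sub (by omega)]
    refine Real.Gamma_strictMonoOn_Ici.monotoneOn ?_ ?_ (by linarith) <;>
      simp only [Set.mem_Ici] <;> linarith
  generalize hb : ⌈|β|⌉₊ = b at hΓ
  have hfac : Tendsto (fun n : ℕ => ‖A * l‖ ^ b * (‖A * l‖ ^ n / (n.factorial : ℝ)))
      atTop (𝓝 0) := by
    simpa using (FloorSemiring.tendsto_pow_div_factorial_atTop ‖A * l‖).const_mul (‖A * l‖ ^ b)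
  have hlarge : ∀ᶠ n : ℕ in atTop, 0 < Real.Gamma (n - β + 1) := by
    filter_upwards [eventually_ge_atTop (b + 2)] with n hn
    exact (by positivity : (0 : ℝ) < (n - b).factorial).trans_le (hΓ n hn)
  refine (isLittleO_iff_tendsto' ?_).2 ?_
  · filter_upwards [hlarge] with n hn h0
    exact absurd h0 (by positivity)
  · rw [← tendsto_add_atTop_iff_nat (b + 2)]
    refine squeeze_zero_norm (fun m => ?_) hfac
    have h1 := hΓ (m + (b + 2)) (by omega)
    have h2 : (m.factorial : ℝ) ≤ ((m + (b + 2) - b).factorial : ℝ) := by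
      exact_mod_cast Nat.factorial_le (by omega)
    have h3 : (0 : ℝ) < m.factorial := by positivity
    have h4 : 0 < Real.Gamma ((m + (b + 2) : ℕ) - β + 1) := by linarith
    rw [show m + (b + 2) - 2 = b + m by omega, div_div_eq_mul_div, ← mul_pow, norm_div, norm_pow,
      Real.norm_of_nonneg h4.le, pow_add, mul_div_assoc]
    gcongr
    linarith

end HeatContent

/-! ### Assembly -/

theorem mainTheorem3 (R : ℝ) (hR : 0 < R) :
    -- the partial fraction decomposition
    (∀ v : ℂ, 1 - 3 * v + 3 * v ^ 2 = 0 ↔ v = HeatContent.v₁ ∨ v = HeatContent.v₂) ∧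
    (∀ v : ℂ, v ≠ HeatContent.v₁ → v ≠ HeatContent.v₂ →
      1 / (1 - 3 * v + 3 * v ^ 2) =
        1 / (3 * (HeatContent.v₁ - HeatContent.v₂)) *
          (1 / (v - HeatContent.v₁) - 1 / (v - HeatContent.v₂))) ∧
    (∀ v : ℂ, ‖v‖ < 1 / √3 →
      HasSum (fun k : ℕ => v ^ k / (3 * (HeatContent.v₁ - HeatContent.v₂)) *
          (1 / HeatContent.v₂ ^ (k + 1) - 1 / HeatContent.v₁ ^ (k + 1)))
        (1 / (1 - 3 * v + 3 * v ^ 2))) ∧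
    -- the Laplace transform of the heat content is a convergent integral
    (∀ s : ℝ, 0 < s → IntegrableOn
      (fun t : ℝ => Real.exp (-s ^ 2 * t) *
        HeatContent.heatContent (Metric.ball (0 : HeatContent.Euc 7) R) t) (Set.Ioi 0)) ∧
    -- it has a Weyl series
    (∃ c : ℕ → ℝ, HeatContent.IsWeylSeries
      (HeatContent.heatContentLaplace (Metric.ball (0 : HeatContent.Euc 7) R)) c) ∧
    ∀ c : ℕ → ℝ, HeatContent.IsWeylSeries
        (HeatContent.heatContentLaplace (Metric.ball (0 : HeatContent.Euc 7) R)) c →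
      -- the exact coefficients
      (∀ n : ℕ, 5 ≤ n → c n = 7 / R ^ (n - 2) * (3 : ℝ) ^ ((n : ℝ) / 2 - 2) *
        (Real.cos (n * Real.pi / 6) - √3 * Real.sin (n * Real.pi / 6))) ∧
      -- rescaled by the characteristic length, they are bounded, periodic and change sign forever
      (∀ n : ℕ, 5 ≤ n → |c n * (R / √3) ^ (n - 2)| ≤ 14 / 3) ∧
      (∀ n : ℕ, 5 ≤ n →
        c (n + 12) * (R / √3) ^ (n + 12 - 2) = c n * (R / √3) ^ (n - 2)) ∧
      (∃ᶠ n in atTop, 0 < c n) ∧ (∃ᶠ n in atTop, c n < 0) ∧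
      -- they are negligible against every Gamma-type growth
      (∀ β l : ℝ, 0 < l → c =o[atTop] fun n : ℕ => Real.Gamma (n - β + 1) / l ^ (n - 2)) ∧
      -- the characteristic length
      HeatContent.IsCharacteristicLength c (R / √3) ∧
      R * ‖HeatContent.v₁‖ = R / √3 ∧ R * ‖HeatContent.v₂‖ = R / √3 ∧
      -- quasi-periodicity
      (∀ n : ℕ, 5 ≤ n → c (n + 12) = 3 ^ 6 * (R ^ 12)⁻¹ * c n) := by
  refine ⟨HeatContent.quadratic_eq_zero_iff, fun v => HeatContent.partial_fraction,
    fun v => HeatContent.hasSum_quadratic_inv,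
    fun s => HeatContent.integrableOn_exp_mul_heatContent,
    ⟨_, HeatContent.isWeylSeries_ballCoeff hR⟩, fun c hc => ?_⟩
  have hcn : ∀ n : ℕ, 5 ≤ n → c n = 7 / R ^ (n - 2) * HeatContent.wave n := fun n hn => by
    rw [hc.unique (HeatContent.isWeylSeries_ballCoeff hR) (by omega),
      HeatContent.ballCoeff_of_five_le R hn]
  have hg : ∀ n : ℕ, 5 ≤ n →
      c n * (R / √3) ^ (n - 2) = 14 / 3 * Real.cos ((n + 2) * Real.pi / 6) := by
    intro n hn
    rw [hcn n hn, ← HeatContent.wave_rescaled (by omega), div_pow]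
    field_simp
  have hpow : ∀ n : ℕ, 0 < (R / √3) ^ (n - 2) := fun n => by positivity
  have hbound : ∀ n : ℕ, 5 ≤ n → |c n * (R / √3) ^ (n - 2)| ≤ 14 / 3 := by
    intro n hn
    rw [hg n hn, abs_mul, abs_of_pos (by norm_num : (0 : ℝ) < 14 / 3)]
    exact mul_le_of_le_one_right (by norm_num) (Real.abs_cos_le_one _)
  have hper : ∀ n : ℕ, 5 ≤ n →
      c (n + 12) * (R / √3) ^ (n + 12 - 2) = c n * (R / √3) ^ (n - 2) := by
    intro n hn
    rw [hg n hn, hg (n + 12) (by omega), HeatContent.cos_add_twelve]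
  -- Along `n = 12m + 10` the phase `(n + 2)π/6` is a multiple of `2π`, and along `12m + 16` it is
  -- shifted by `π`. The extremes `±14/3` give both signs, and the first excludes the limit 0.
  have hcos1 : ∀ m : ℕ, c (12 * m + 10) * (R / √3) ^ (12 * m + 10 - 2) = 14 / 3 := by
    intro m
    rw [hg _ (by omega), show ((12 * m + 10 : ℕ) + 2 : ℝ) * Real.pi / 6 =
      ((m + 1 : ℕ) : ℝ) * (2 * Real.pi) by push_cast; ring, Real.cos_nat_mul_two_pi, mul_one]
  have hcos2 : ∀ m : ℕ, c (12 * m + 16) * (R / √3) ^ (12 * m + 16 - 2) = -(14 / 3) := by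
    intro m
    rw [hg _ (by omega), show ((12 * m + 16 : ℕ) + 2 : ℝ) * Real.pi / 6 =
      ((m + 1 : ℕ) : ℝ) * (2 * Real.pi) + Real.pi by push_cast; ring,
      Real.cos_nat_mul_two_pi_add_pi]
    ring
  refine ⟨fun n hn => ?_, hbound, hper, ?_, ?_, fun β l hl => ?_, ⟨by positivity, ?_, ?_⟩,
    ?_, ?_, fun n hn => ?_⟩
  · rw [hcn n hn, HeatContent.wave_eq, mul_assoc]
  · refine frequently_atTop.2 fun a => ⟨12 * a + 10, by omega, ?_⟩
    exact pos_of_mul_pos_left (by rw [hcos1]; norm_num) (hpow (12 * a + 10)).le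
  · refine frequently_atTop.2 fun a => ⟨12 * a + 16, by omega, ?_⟩
    exact neg_of_mul_neg_left (by rw [hcos2]; norm_num) (hpow (12 * a + 16)).le
  -- The bound on the rescaled coefficients says `c n = O((√3/R)^(n-2))`.
  · refine IsBigO.trans_isLittleO ?_ (HeatContent.isLittleO_pow_Gamma (√3 / R) β hl)
    refine IsBigO.of_bound (14 / 3) ?_
    filter_upwards [eventually_ge_atTop 5] with n hn
    have h1 := hbound n hn
    rw [abs_mul, abs_of_pos (hpow n)] at h1
    rw [← inv_div R, inv_pow, norm_inv, Real.norm_of_nonneg (hpow n).le, ← div_eq_mul_inv,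
      le_div_iff₀ (hpow n)]
    exact h1
  -- The finite sum absorbs the exceptional coefficients below `n = 5`.
  · refine ⟨14 / 3 + ∑ k ∈ Finset.range 5, |c k * (R / √3) ^ (k - 2)|, fun n _ => ?_⟩
    have hsum : 0 ≤ ∑ k ∈ Finset.range 5, |c k * (R / √3) ^ (k - 2)| :=
      Finset.sum_nonneg fun _ _ => abs_nonneg _
    rcases lt_or_ge n 5 with h | h
    · have := Finset.single_le_sum (f := fun k => |c k * (R / √3) ^ (k - 2)|)
        (fun _ _ => abs_nonneg _) (Finset.mem_range.2 h)
      linarith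
    · linarith [hbound n h]
  · intro h
    have h1 : Tendsto (fun m : ℕ => 12 * m + 10) atTop atTop :=
      tendsto_atTop_mono (fun m => by simp only [id]; omega) tendsto_id
    have h2 := h.comp h1
    simp only [Function.comp_def, hcos1] at h2
    have := tendsto_nhds_unique h2 tendsto_const_nhds
    norm_num at this
  · rw [HeatContent.norm_v₁, mul_one_div]
  · rw [HeatContent.norm_v₂, mul_one_div]
  · have h1 := hper n hn
    have h12 : √3 ^ 12 = 3 ^ 6 := by
      rw [show 12 = 2 * 6 by norm_num, pow_mul, Real.sq_sqrt (by norm_num)]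
    rw [show n + 12 - 2 = 12 + (n - 2) by omega, pow_add, ← mul_assoc] at h1
    have h2 := mul_right_cancel₀ (hpow n).ne' h1
    rw [← h2, div_pow, h12]
    field_simp
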